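/- Identify sets of natural numbers with elements of Cantor space $2^{\mathbb N}$, and let $\lambda$ be the fair-coin (uniform product) measure on $2^{\mathbb N}$. A $\Pi^0_1$ class is the complement of an open set $\{Z : \exists n\; Z\upharpoonright n\in W\}$ generated by a computably enumerable set $W$ of binary strings. A set $Z$ is ML-random if for every uniformly c.e. sequence $(V_m)_{m\in\mathbb N}$ of sets of strings generating open sets $U_m$ with $\lambda(U_m)\le 2^{-m}$ for all $m$, one has $Z\notin\bigcap_m U_m$. A set $A$ is $K$-trivial if there is a constant $b$ with $K(A\upharpoonright n)\le K(n)+b$ for all $n$, where $K$ is prefix-free Kolmogorov complexity (with respect to an optimal prefix-free machine, the number $n$ being represented by the string $0^n$). Write $\le_T$ for Turing reducibility, $Z'=\{e : \Phi^Z_e(e)\downarrow\}$ for the Turing jump of $Z$, where $(\Phi_e)_{e\in\mathbb N}$ is a standard list of the Turing functionals, and $G\le_{tt}A$ for truth-table reducibility: there is a computable sequence $(\theta_n)_{n\in\mathbb N}$ of truth-table conditions such that, for every $n$, $n\in G$ if and only if $A$ satisfies $\theta_n$. **Theorem.** Let $S$ be a nonempty $\Pi^0_1$ class all of whose members are ML-random.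 Then there is a $K$-trivial c.e. set $B$ such that for every set $G\subseteq\mathbb N$ there is $Z\in S$ with $B\not\le_T Z$ and $G\le_{tt}Z'$. -/

import Mathlib

namespace Cantor

/-! Sets of natural numbers are identified with their characteristic functions `ℕ → Bool`,
i.e. with points of Cantor space; strings are elements of `List Bool`. -/

/-- The initial segment `Z ↾ n = Z(0) Z(1) … Z(n-1)`. -/
def initSeg (Z : ℕ → Bool) (n : ℕ) : List Bool :=
  (List.range n).map Z

/-- The open subset of Cantor space generated by a set `W` of strings: all sequences that
extend a string of `W`. -/
def openOf (W : Set (List Bool)) : Set (ℕ → Bool) :=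
  {Z | ∃ n, initSeg Z n ∈ W}

/-- `A` is computably enumerable. -/
def IsCE (A : ℕ → Bool) : Prop :=
  REPred fun n => A n = true

/-- A `Π⁰₁` class: the complement of the open set generated by a c.e. set of strings. -/
def IsPi01Class (S : Set (ℕ → Bool)) : Prop :=
  ∃ W : Set (List Bool), (REPred fun σ => σ ∈ W) ∧ S = (openOf W)ᶜ

/-! ### Martin-Löf randomness -/

/-- The fair-coin (Lebesgue) measure on Cantor space. -/
noncomputable def fairCoin : MeasureTheory.Measure (ℕ → Bool) :=
  MeasureTheory.Measure.infinitePi fun _ : ℕ => (PMF.uniformOfFintype Bool).toMeasure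

/-- A Martin-Löf test, given by a uniformly c.e. sequence of sets of strings. -/
def IsMLTest (V : ℕ → Set (List Bool)) : Prop :=
  (REPred fun p : ℕ × List Bool => p.2 ∈ V p.1) ∧
    ∀ m, fairCoin (openOf (V m)) ≤ (2 : ENNReal)⁻¹ ^ m

/-- `Z` is Martin-Löf random: no Martin-Löf test captures it. -/
def IsMLRandom (Z : ℕ → Bool) : Prop :=
  ∀ V, IsMLTest V → ∃ m, Z ∉ openOf (V m)

/-! ### Prefix-free complexity and `K`-triviality -/

/-- A prefix-free machine: a partial computable function on strings no two distinct elements of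
whose domain are comparable under the prefix relation. -/
def IsPrefixFreeMachine (M : List Bool →. List Bool) : Prop :=
  Partrec M ∧ ∀ σ τ, (M σ).Dom → (M τ).Dom → σ <+: τ → σ = τ

/-- An optimal (universal) prefix-free machine: it simulates every prefix-free machine with a
constant increase of the lengths of descriptions. -/
def IsOptimalMachine (U : List Bool →. List Bool) : Prop :=
  IsPrefixFreeMachine U ∧ ∀ M, IsPrefixFreeMachine M →
    ∃ d : ℕ, ∀ σ x, x ∈ M σ → ∃ τ, x ∈ U τ ∧ τ.length ≤ σ.length + d

open Nat.Partrec (Code) in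
/-- `trimGood c k σ`: no string comparable to `σ`, other than `σ`, is accepted by `c` within `k`
steps. -/
def trimGood (c : Code) (k : ℕ) (σ : List Bool) : Prop :=
  ∀ m < k, ∀ τ ∈ Encodable.decode (α := List Bool) m,
    τ ≠ σ → (τ <+: σ ∨ σ <+: τ) → Code.evaln k c m = none

section Optimal

open Nat.Partrec (Code)
open Encodable

theorem trimGood_iff (c : Code) (k : ℕ) (σ : List Bool) : trimGood c k σ ↔
    ∀ m < k, (fun (m : ℕ) (q : (Code × ℕ) × List Bool) =>
      ((decode (α := List Bool) m).getD q.2 = q.2 ∨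
      ¬ ((decode (α := List Bool) m).getD q.2 = q.2.take ((decode (α := List Bool) m).getD q.2).length ∨
        q.2 = ((decode (α := List Bool) m).getD q.2).take q.2.length)) ∨
      Code.evaln q.1.2 q.1.1 m = none) m ((c, k), σ) := by
  unfold trimGood
  refine forall₂_congr fun m _ => ?_
  cases h : decode (α := List Bool) m with
  | none => simp [h]
  | some τ =>
    simp only [h, Option.mem_def, Option.some.injEq, forall_eq', Option.getD_some,
      List.prefix_iff_eq_take]
    tauto

theorem trimGood_prim :
    PrimrecPred fun q : (Code × ℕ) × List Bool => trimGood q.1.1 q.1.2 q.2 := by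
  have hd : Primrec fun p : ℕ × ((Code × ℕ) × List Bool) =>
      (decode (α := List Bool) p.1).getD p.2.2 :=
    Primrec.option_getD.comp (Primrec.decode.comp Primrec.fst) (Primrec.snd.comp Primrec.snd)
  have hs : Primrec fun p : ℕ × ((Code × ℕ) × List Bool) => p.2.2 :=
    Primrec.snd.comp Primrec.snd
  have he : Primrec fun p : ℕ × ((Code × ℕ) × List Bool) =>
      Code.evaln p.2.1.2 p.2.1.1 p.1 :=
    Code.primrec_evaln.comp (Primrec.pair (Primrec.pair
      (Primrec.snd.comp (Primrec.fst.comp Primrec.snd))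
      (Primrec.fst.comp (Primrec.fst.comp Primrec.snd))) Primrec.fst)
  have hR : PrimrecRel fun (m : ℕ) (q : (Code × ℕ) × List Bool) =>
      ((decode (α := List Bool) m).getD q.2 = q.2 ∨
      ¬ ((decode (α := List Bool) m).getD q.2 = q.2.take ((decode (α := List Bool) m).getD q.2).length ∨
        q.2 = ((decode (α := List Bool) m).getD q.2).take q.2.length)) ∨
      Code.evaln q.1.2 q.1.1 m = none :=
    ((Primrec.eq.comp hd hs).or
      ((Primrec.eq.comp hd (Primrec.list_take.comp (Primrec.list_length.comp hd) hs)).or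
        (Primrec.eq.comp hs (Primrec.list_take.comp (Primrec.list_length.comp hs) hd))).not).or
      (Primrec.eq.comp he (Primrec.const none))
  have hF := PrimrecRel.comp hR.forall_mem_list
    (Primrec.list_range.comp (Primrec.snd.comp Primrec.fst) :
      Primrec fun q : (Code × ℕ) × List Bool => List.range q.1.2) Primrec.id
  refine hF.of_eq ?_
  rintro ⟨⟨c, k⟩, σ⟩
  simpa only [List.mem_range, id] using (trimGood_iff c k σ).symm

open Classical in
/-- One step of the trimmed machine of `c`. -/
noncomputable def trimStep (c : Code) (σ : List Bool) (k : ℕ) : Option (List Bool) :=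
  if trimGood c k σ then (Code.evaln k c (encode σ)).bind decode else none

/-- The number of leading `0`s of a string. -/
def zeros (p : List Bool) : ℕ := p.findIdx id

/-- The standard machine: `0ᵉ1σ` is read as the input `σ` for the `e`-th trimmed machine. -/
noncomputable def stdMachine : List Bool →. List Bool := fun p =>
  Nat.rfindOpt fun k =>
    if zeros p < p.length then
      trimStep (Denumerable.ofNat Code (zeros p)) (p.drop (zeros p + 1)) k
    else none

theorem stdMachine_partrec : Partrec stdMachine := by
  classical
  have hz : Primrec zeros := Primrec.list_findIdx Primrec.id (Primrec.snd)
  have hstep : Primrec fun q : (Code × ℕ) × List Bool => trimStep q.1.1 q.2 q.1.2 := by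
    refine Primrec.ite trimGood_prim (Primrec.option_bind ?_ (Primrec.decode.comp Primrec.snd))
      (Primrec.const none)
    exact Code.primrec_evaln.comp (Primrec.pair (Primrec.pair
      (Primrec.snd.comp Primrec.fst) (Primrec.fst.comp Primrec.fst))
      (Primrec.encode.comp Primrec.snd))
  refine Partrec.rfindOpt (Primrec.to_comp ?_)
  have hz' : Primrec fun q : List Bool × ℕ => zeros q.1 := hz.comp Primrec.fst
  refine Primrec.ite (Primrec.nat_lt.comp hz' (Primrec.list_length.comp Primrec.fst)) ?_
    (Primrec.const none)
  exact hstep.comp (Primrec.pair (Primrec.pair ((Primrec.ofNat Code).comp hz') Primrec.snd)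
    (Primrec.list_drop.comp (Primrec.succ.comp hz') Primrec.fst))

theorem zeros_lt_iff (p : List Bool) (h : zeros p < p.length) :
    p = List.replicate (zeros p) false ++ true :: p.drop (zeros p + 1) := by
  induction p with
  | nil => simp at h
  | cons a p ih =>
    cases a with
    | true => simp [zeros, List.findIdx_cons]
    | false =>
      have e : zeros (false :: p) = zeros p + 1 := by simp [zeros, List.findIdx_cons]
      rw [e] at h ⊢
      have := ih (by simpa using h)
      simpa [List.replicate_succ] using this

theorem zeros_append (e : ℕ) (σ : List Bool) :
    zeros (List.replicate e false ++ true :: σ) = e := by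
  induction e with
  | zero => simp [zeros, List.findIdx_cons]
  | succ e ih =>
    simp only [zeros] at ih
    simp [zeros, List.replicate_succ, List.findIdx_cons, ih]

theorem trimStep_disjoint {c : Code} {σ τ : List Bool} {k l : ℕ} {x y : List Bool}
    (hσ : x ∈ trimStep c σ k) (hτ : y ∈ trimStep c τ l) (h : σ <+: τ ∨ τ <+: σ) (hkl : k ≤ l) :
    σ = τ := by
  by_contra hne
  simp only [trimStep, Option.mem_def] at hσ hτ
  split_ifs at hσ hτ with h1 h2
  obtain ⟨u, hu, -⟩ := Option.bind_eq_some_iff.1 hσ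
  have hu' : u ∈ Code.evaln l c (encode σ) := Code.evaln_mono hkl hu
  have := h2 _ (Code.evaln_bound hu') σ (by simp) hne h
  simp [this] at hu'

theorem stdMachine_prefixFree : IsPrefixFreeMachine stdMachine := by
  refine ⟨stdMachine_partrec, fun p q hp hq hpq => ?_⟩
  obtain ⟨k, x, hx⟩ := Nat.rfindOpt_dom.1 hp
  obtain ⟨l, y, hy⟩ := Nat.rfindOpt_dom.1 hq
  by_cases hp' : zeros p < p.length
  swap
  · simp [hp'] at hx
  by_cases hq' : zeros q < q.length
  swap
  · simp [hq'] at hy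
  simp only [hp', hq', if_true] at hx hy
  have ep := zeros_lt_iff p hp'
  have eq := zeros_lt_iff q hq'
  have hz : zeros q = zeros p := by
    obtain ⟨r, rfl⟩ := hpq
    conv_lhs => rw [ep]
    rw [List.append_assoc, List.cons_append, zeros_append]
  rw [hz] at hy eq
  have hcomp : p.drop (zeros p + 1) <+: q.drop (zeros p + 1) := by
    rw [ep, eq] at hpq
    simpa using hpq
  have : p.drop (zeros p + 1) = q.drop (zeros p + 1) := by
    rcases le_total k l with hkl | hkl
    · exact trimStep_disjoint hx hy (Or.inl hcomp) hkl
    · exact (trimStep_disjoint hy hx (Or.inr hcomp) hkl).symm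
  rw [ep, eq, this]

theorem drop_append (e : ℕ) (σ : List Bool) :
    (List.replicate e false ++ true :: σ).drop (e + 1) = σ := by
  simp [List.drop_append]

/-- Optimal prefix-free machines exist. -/
theorem exists_isOptimalMachine : ∃ U, IsOptimalMachine U := by
  refine ⟨stdMachine, stdMachine_prefixFree, fun M hM => ?_⟩
  obtain ⟨c, hc⟩ := Code.exists_code.1 hM.1
  have hc' : ∀ τ : List Bool, Code.eval c (encode τ) = (M τ).map encode := by
    intro τ; rw [hc]; simp
  refine ⟨encode c + 1, fun σ x hx => ⟨List.replicate (encode c) false ++ true :: σ, ?_, ?_⟩⟩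
  swap
  · simp; omega
  have hgood : ∀ k, trimGood c k σ := by
    intro k m _ τ hτ hne hcomp
    by_contra hcon
    obtain ⟨u, hu⟩ := Option.ne_none_iff_exists'.1 hcon
    have h1 := Code.evaln_sound (Option.mem_def.2 hu)
    rw [hc] at h1
    simp only [Option.mem_def.1 hτ, Part.coe_some, Part.bind_some, Part.mem_map_iff] at h1
    obtain ⟨z, hz, -⟩ := h1
    have hτd : (M τ).Dom := Part.dom_iff_mem.2 ⟨z, hz⟩
    have hσd : (M σ).Dom := Part.dom_iff_mem.2 ⟨x, hx⟩
    rcases hcomp with h | h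
    · exact hne (hM.2 _ _ hτd hσd h)
    · exact hne (hM.2 _ _ hσd hτd h).symm
  have hx' : encode x ∈ Code.eval c (encode σ) := by
    rw [hc']; exact Part.mem_map _ hx
  obtain ⟨k, hk⟩ := Code.evaln_complete.1 hx'
  have hdom : (stdMachine (List.replicate (encode c) false ++ true :: σ)).Dom := by
    refine Nat.rfindOpt_dom.2 ⟨k, x, ?_⟩
    simp [zeros_append, drop_append, trimStep, hgood, Option.mem_def.1 hk]
  obtain ⟨y, hy⟩ := Part.dom_iff_mem.1 hdom
  obtain ⟨l, hl⟩ := Nat.rfindOpt_spec hy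
  have hl' : ((Code.evaln l c (encode σ)).bind decode : Option (List Bool)) = some y := by
    simpa [zeros_append, drop_append, trimStep, hgood] using hl
  obtain ⟨u, hu, hu'⟩ := Option.bind_eq_some_iff.1 hl'
  have h1 := Part.mem_unique (Code.evaln_sound (Option.mem_def.2 hu)) hx'
  subst h1
  simp only [encodek, Option.some.injEq] at hu'
  subst hu'
  exact hy

end Optimal

/-- The complexity `K_M(x)`: the least length of an `M`-description of `x` (`⊤` if none). -/
noncomputable def prefixComplexity (M : List Bool →. List Bool) (x : List Bool) : ℕ∞ :=
  ⨅ (σ : List Bool) (_ : x ∈ M σ), (σ.length : ℕ∞)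

/-- `A` is `K`-trivial: `K(A ↾ n) ≤ K(n) + b` for a constant `b`, where the number `n` is
represented by the string `0ⁿ` and `K = K_U` for an optimal prefix-free machine `U` (these exist,
see `exists_isOptimalMachine`; the choice of `U` only affects the constant `b`). -/
def IsKTrivial (A : ℕ → Bool) : Prop :=
  ∀ U, IsOptimalMachine U →
    ∃ b : ℕ, ∀ n,
      prefixComplexity U (initSeg A n) ≤ prefixComplexity U (List.replicate n false) + b

/-! ### Turing reducibility and the jump -/

/-- The characteristic function of `A` as an oracle. -/
def char (A : ℕ → Bool) : ℕ →. ℕ :=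
  fun n => Part.some (A n).toNat

/-- `B ≤_T Z`. -/
def TReducible (B Z : ℕ → Bool) : Prop :=
  TuringReducible (char B) (char Z)

/-- Programs for oracle computation: one constructor for each clause of `Nat.RecursiveIn`. -/
inductive OCode : Type
  | zero : OCode
  | succ : OCode
  | left : OCode
  | right : OCode
  | oracle : OCode
  | pair : OCode → OCode → OCode
  | comp : OCode → OCode → OCode
  | prec : OCode → OCode → OCode
  | rfind : OCode → OCode

namespace OCode

/-- The partial function computed by a program with oracle `X`. -/
def eval (X : ℕ → Bool) : OCode → ℕ →. ℕ
  | zero => fun _ => Part.some 0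
  | succ => fun n => Part.some (n + 1)
  | left => fun n => Part.some n.unpair.1
  | right => fun n => Part.some n.unpair.2
  | oracle => char X
  | pair c d => fun n => Nat.pair <$> eval X c n <*> eval X d n
  | comp c d => fun n => eval X d n >>= eval X c
  | prec c d => fun p =>
      let (a, n) := Nat.unpair p
      n.rec (eval X c a) fun y IH => do
        let i ← IH
        eval X d (Nat.pair a (Nat.pair y i))
  | rfind c => fun a =>
      Nat.rfind fun n => (fun m => m = 0) <$> eval X c (Nat.pair a n)

/-- The number of a program. -/
def toNat : OCode → ℕ
  | zero => 0
  | succ => 1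
  | left => 2
  | right => 3
  | oracle => 4
  | pair c d => 4 * Nat.pair (toNat c) (toNat d) + 5
  | comp c d => 4 * Nat.pair (toNat c) (toNat d) + 6
  | prec c d => 4 * Nat.pair (toNat c) (toNat d) + 7
  | rfind c => 4 * toNat c + 8

/-- The program with a given number. -/
def ofNat : ℕ → OCode
  | 0 => zero
  | 1 => succ
  | 2 => left
  | 3 => right
  | 4 => oracle
  | n + 5 =>
    have h0 : n / 4 < n + 5 := by omega
    have h1 : (n / 4).unpair.1 < n + 5 := lt_of_le_of_lt (Nat.unpair_left_le _) h0
    have h2 : (n / 4).unpair.2 < n + 5 := lt_of_le_of_lt (Nat.unpair_right_le _) h0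
    match n % 4 with
    | 0 => pair (ofNat (n / 4).unpair.1) (ofNat (n / 4).unpair.2)
    | 1 => comp (ofNat (n / 4).unpair.1) (ofNat (n / 4).unpair.2)
    | 2 => prec (ofNat (n / 4).unpair.1) (ofNat (n / 4).unpair.2)
    | _ => rfind (ofNat (n / 4))

theorem ofNat_toNat (c : OCode) : ofNat (toNat c) = c := by
  induction c with
  | zero | succ | left | right | oracle => simp [toNat, ofNat]
  | pair c d hc hd =>
    rw [toNat, ofNat]
    have h1 : (4 * Nat.pair (toNat c) (toNat d)) % 4 = 0 := by omega
    have h2 : (4 * Nat.pair (toNat c) (toNat d)) / 4 = Nat.pair (toNat c) (toNat d) := by omega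
    simp [h1, h2, hc, hd]
  | comp c d hc hd =>
    rw [toNat, show ∀ a, 4 * a + 6 = (4 * a + 1) + 5 from fun a => rfl, ofNat]
    have h1 : (4 * Nat.pair (toNat c) (toNat d) + 1) % 4 = 1 := by omega
    have h2 : (4 * Nat.pair (toNat c) (toNat d) + 1) / 4 = Nat.pair (toNat c) (toNat d) := by
      omega
    simp [h1, h2, hc, hd]
  | prec c d hc hd =>
    rw [toNat, show ∀ a, 4 * a + 7 = (4 * a + 2) + 5 from fun a => rfl, ofNat]
    have h1 : (4 * Nat.pair (toNat c) (toNat d) + 2) % 4 = 2 := by omega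
    have h2 : (4 * Nat.pair (toNat c) (toNat d) + 2) / 4 = Nat.pair (toNat c) (toNat d) := by
      omega
    simp [h1, h2, hc, hd]
  | rfind c hc =>
    rw [toNat, show ∀ a, 4 * a + 8 = (4 * a + 3) + 5 from fun a => rfl, ofNat]
    have h1 : (4 * toNat c + 3) % 4 = 3 := by omega
    have h2 : (4 * toNat c + 3) / 4 = toNat c := by omega
    simp [h1, h2, hc]

/-- The programs compute exactly the functions partial computable in the oracle. -/
theorem turingReducible_iff_exists_eval (X : ℕ → Bool) (f : ℕ →. ℕ) :
    TuringReducible f (char X) ↔ ∃ c : OCode, eval X c = f := by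
  rw [TuringReducible, RecursiveIn.iff_nat]
  constructor
  · intro h
    induction h with
    | zero => exact ⟨zero, rfl⟩
    | succ => exact ⟨succ, rfl⟩
    | left => exact ⟨left, rfl⟩
    | right => exact ⟨right, rfl⟩
    | oracle g hg => exact ⟨oracle, (Set.mem_singleton_iff.1 hg).symm⟩
    | pair _ _ h1 h2 =>
      obtain ⟨c, rfl⟩ := h1; obtain ⟨d, rfl⟩ := h2
      exact ⟨pair c d, rfl⟩
    | comp _ _ h1 h2 =>
      obtain ⟨c, rfl⟩ := h1; obtain ⟨d, rfl⟩ := h2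
      exact ⟨comp c d, rfl⟩
    | prec _ _ h1 h2 =>
      obtain ⟨c, rfl⟩ := h1; obtain ⟨d, rfl⟩ := h2
      exact ⟨prec c d, rfl⟩
    | rfind _ h1 =>
      obtain ⟨c, rfl⟩ := h1
      exact ⟨rfind c, rfl⟩
  · rintro ⟨c, rfl⟩
    induction c with
    | zero => exact .zero
    | succ => exact .succ
    | left => exact .left
    | right => exact .right
    | oracle => exact .oracle _ rfl
    | pair c d hc hd => exact .pair hc hd
    | comp c d hc hd => exact .comp hc hd
    | prec c d hc hd => exact .prec hc hd
    | rfind c hc => exact .rfind hc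

end OCode

/-- `Φ_e^X`, the `e`-th function partial computable in `X`. -/
def Phi (e : ℕ) (X : ℕ → Bool) : ℕ →. ℕ :=
  OCode.eval X (OCode.ofNat e)

open Classical in
/-- The jump `X' = {e : Φ_e^X(e)↓}`. -/
noncomputable def jump (X : ℕ → Bool) : ℕ → Bool :=
  fun e => decide (Phi e X e).Dom

/-! ### Truth-table reducibility -/

/-- A truth-table condition: a list of queries together with the list of those rows of the truth
table (vectors of answers to the queries) that are accepted. -/
abbrev TTCondition : Type :=
  List ℕ × List (List Bool)

/-- `A` satisfies the truth-table condition `t`. -/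
def TTCondition.Holds (t : TTCondition) (A : ℕ → Bool) : Prop :=
  t.1.map A ∈ t.2

/-- `G ≤_tt A`: there is a computable sequence of truth-table conditions, the `n`-th of which is
satisfied by `A` if and only if `n ∈ G`. -/
def TTReducible (G A : ℕ → Bool) : Prop :=
  ∃ f : ℕ → TTCondition, Computable f ∧ ∀ n, G n = true ↔ (f n).Holds A

end Cantor

/-!
The set `B` is built once and for all; the sets `Z` are obtained from it by forcing with `Π⁰₁`
classes, all of whose indices can be found from `Z'` by a truth-table reduction.

*Coding.* A nonempty `Π⁰₁` class of random sets cannot be too small: there is a single Martin-Löf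
test (`splitTest`) whose `m`-th component catches every member of the `q`-th `Π⁰₁` class if this
class does not branch below `m + q + 1`. One random member of `S` escapes the `m`-th component for
some `m`; hence `S` may be replaced by its nonempty `Π⁰₁` subclass outside this component, and all
nonempty `Π⁰₁` subclasses of that branch below a computable bound (`exists_split`). At the first
position where the current class branches, `Z` takes the value `G(e)`.

*Diagonalization.* For each pair `k` of a number `e` and an index `q` there is a requirement with a
witness `w`. It waits until the class of those `Z` in the `q`-th class for which `Φ_e` with oracle
`Z` does not return `0` on `w` is seen to be empty, and then enumerates `w` into `B`. If this
happens, no member of the `q`-th class computes `B` via `Φ_e`; otherwise no member of that nonempty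
subclass does (`satisfyIndex_spec`). The requirements do not interfere with one another.

*`K`-triviality.* The enumeration of `w` makes it necessary to describe anew the initial segments
of `B` of lengths above `w`. This costs the weight of the descriptions of these lengths, and the
witness is replaced by a fresh one when that exceeds `2⁻ᵏ`. The total cost is thus finite, and a
machine is obtained from the resulting requests by laying out their weights in the unit interval
(`exists_machine_of_requests`).

*Truth-table reducibility.* Different witnesses of a requirement become expensive because of
disjoint sets of descriptions, so there are at most `2ᵏ` replacements (`resets_le`). Therefore the
next class depends only on boundedly many `Σ⁰₁` facts and one bit of `Z`, all of which are queries
to `Z'`. The index of the class after `e` steps is found by iterating this; since the bounds on the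
queries are computable, considering all potential answers shows that the iteration is a
truth-table reduction too (`TTComputable.iterate`).

Computations with an oracle are reduced to computations without oracle by translating the programs
into programs that receive a finite initial segment of the oracle as part of their input (`toCode`).
-/

namespace Cantor

open Nat.Partrec (Code)
open Encodable

/-! ### Primitive recursion toolkit -/

theorem primrec_nat_pow : Primrec₂ ((· ^ ·) : ℕ → ℕ → ℕ) :=
  Primrec₂.unpaired'.1 Nat.Primrec.pow

section Bounded

variable {α : Type*} [Primcodable α]

theorem primrecPred_forall_lt {f : α → ℕ} {R : α → ℕ → Prop} (hf : Primrec f)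
    (hR : PrimrecRel R) : PrimrecPred fun a => ∀ i < f a, R a i := by
  refine ((PrimrecRel.forall_mem_list hR.swap).comp (Primrec.list_range.comp hf)
    Primrec.id).of_eq fun a => ?_
  simp [Function.swap]

theorem primrecPred_exists_lt {f : α → ℕ} {R : α → ℕ → Prop} (hf : Primrec f)
    (hR : PrimrecRel R) : PrimrecPred fun a => ∃ i < f a, R a i := by
  refine ((PrimrecRel.exists_mem_list hR.swap).comp (Primrec.list_range.comp hf)
    Primrec.id).of_eq fun a => ?_
  simp [Function.swap]

theorem primrec_sum_range {f : α → ℕ} {g : α → ℕ → ℕ} (hf : Primrec f) (hg : Primrec₂ g) :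
    Primrec fun a => ∑ i ∈ Finset.range (f a), g a i := by
  have h := Primrec.nat_rec' (h := fun a (p : ℕ × ℕ) => p.2 + g a p.1) hf (Primrec.const 0)
    (Primrec.nat_add.comp (Primrec.snd.comp Primrec.snd)
      (hg.comp Primrec.fst (Primrec.fst.comp Primrec.snd)))
  refine h.of_eq fun a => ?_
  induction f a with
  | zero => rfl
  | succ n ih => rw [Finset.sum_range_succ, ← ih]

/-- A predicate is recursively enumerable exactly if it is the projection of a primitive
recursive relation. -/
theorem rePred_iff_exists_primrecRel {p : α → Prop} :
    REPred p ↔ ∃ R : α → ℕ → Prop, PrimrecRel R ∧ ∀ a, p a ↔ ∃ s, R a s := by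
  constructor
  · intro h
    obtain ⟨c, hc⟩ := Code.exists_code.1 h
    refine ⟨fun a s => (Code.evaln s c (encode a)).isSome = true, ?_, fun a => ?_⟩
    · exact Primrec.eq.comp (Primrec.option_isSome.comp (Code.primrec_evaln.comp
        (Primrec.pair (Primrec.pair Primrec.snd (Primrec.const c))
          (Primrec.encode.comp Primrec.fst)))) (Primrec.const true)
    · have : p a ↔ (Code.eval c (encode a)).Dom := by
        rw [hc]; simp [Part.assert]
      rw [this, Part.dom_iff_mem]
      simp only [Code.evaln_complete, Option.isSome_iff_exists, Option.mem_def]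
      exact exists_comm
  · rintro ⟨R, hR, h⟩
    classical
    have : Partrec fun a => Nat.rfindOpt fun s => if R a s then some () else none :=
      Partrec.rfindOpt (Primrec.ite hR (Primrec.const (some ())) (Primrec.const none)).to_comp
    refine this.dom_re.of_eq fun a => ?_
    rw [h, Nat.rfindOpt_dom]
    simp

theorem rePred_of_primrecRel {R : α → ℕ → Prop} (hR : PrimrecRel R) :
    REPred fun a => ∃ s, R a s :=
  rePred_iff_exists_primrecRel.2 ⟨R, hR, fun _ => Iff.rfl⟩

end Bounded

/-! ### Finite strings -/

/-- The list of all strings of a given length. -/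
def strings : ℕ → List (List Bool)
  | 0 => [[]]
  | n + 1 => (strings n).flatMap fun σ => [false :: σ, true :: σ]

theorem mem_strings {n : ℕ} {σ : List Bool} : σ ∈ strings n ↔ σ.length = n := by
  induction n generalizing σ with
  | zero => simp [strings]
  | succ n ih =>
    simp only [strings, List.mem_flatMap, ih, List.mem_cons, List.not_mem_nil, or_false]
    constructor
    · rintro ⟨τ, h, rfl | rfl⟩ <;> simp [h]
    · intro h
      cases σ with
      | nil => simp at h
      | cons a σ =>
        refine ⟨σ, by simpa using h, ?_⟩
        cases a <;> simp

theorem primrec_strings : Primrec strings := by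
  have h := Primrec.nat_rec₁ (f := fun _ (l : List (List Bool)) =>
    l.flatMap fun σ => [false :: σ, true :: σ]) [[]] (by
      refine Primrec.list_flatMap Primrec.snd ?_
      have hc : ∀ b : Bool, Primrec fun p : (ℕ × List (List Bool)) × List Bool => b :: p.2 :=
        fun b => Primrec.list_cons.comp (Primrec.const b) Primrec.snd
      exact Primrec.list_cons.comp (hc false) (Primrec.list_cons.comp (hc true) (Primrec.const [])))
  refine h.of_eq fun n => ?_
  induction n with
  | zero => rfl
  | succ n ih => simp only [strings, ← ih]

@[simp] theorem length_initSeg (Z : ℕ → Bool) (n : ℕ) : (initSeg Z n).length = n := by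
  simp [initSeg]

theorem initSeg_mem_strings (Z : ℕ → Bool) (n : ℕ) : initSeg Z n ∈ strings n :=
  mem_strings.2 (length_initSeg Z n)

theorem getElem?_initSeg (Z : ℕ → Bool) {n i : ℕ} (h : i < n) :
    (initSeg Z n)[i]? = some (Z i) := by
  simp [initSeg, h]

theorem take_initSeg (Z : ℕ → Bool) {i n : ℕ} (h : i ≤ n) :
    (initSeg Z n).take i = initSeg Z i := by
  simp [initSeg, ← List.map_take, List.take_range, h]

theorem initSeg_congr {Y Z : ℕ → Bool} {n : ℕ} (h : ∀ i < n, Y i = Z i) :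
    initSeg Y n = initSeg Z n := by
  simp only [initSeg, List.map_inj_left, List.mem_range]
  exact h

theorem initSeg_getD (σ : List Bool) : initSeg (fun i => σ.getD i false) σ.length = σ := by
  refine List.ext_getElem (by simp) fun i h₁ h₂ => ?_
  simp [initSeg, h₂]

theorem getD_initSeg (Z : ℕ → Bool) {n i : ℕ} (h : i < n) :
    (initSeg Z n).getD i false = Z i := by
  simp [List.getD, getElem?_initSeg Z h]

end Cantor

namespace Cantor

open Nat.Partrec (Code)
open Encodable Denumerable

/-! ### Indices of `Π⁰₁` classes -/

/-- The string `σ` is enumerated into the `q`-th c.e. set of strings within `s` steps. -/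
def EnumBy (q : ℕ) (σ : List Bool) (s : ℕ) : Prop :=
  (Code.evaln s (ofNat Code q) (encode σ)).isSome = true

/-- The `q`-th c.e. set of strings. -/
def ceStrings (q : ℕ) : Set (List Bool) :=
  {σ | ∃ s, EnumBy q σ s}

/-- The `q`-th `Π⁰₁` class. -/
def piClass (q : ℕ) : Set (ℕ → Bool) :=
  (openOf (ceStrings q))ᶜ

theorem EnumBy.mono {q : ℕ} {σ : List Bool} {s t : ℕ} (h : EnumBy q σ s) (hst : s ≤ t) :
    EnumBy q σ t := by
  obtain ⟨x, hx⟩ := Option.isSome_iff_exists.1 h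
  exact Option.isSome_iff_exists.2 ⟨x, Code.evaln_mono hst hx⟩

theorem primrec_enumBy {α : Type*} [Primcodable α] {q : α → ℕ} {σ : α → List Bool} {s : α → ℕ}
    (hq : Primrec q) (hσ : Primrec σ) (hs : Primrec s) :
    PrimrecPred fun a => EnumBy (q a) (σ a) (s a) :=
  Primrec.eq.comp (Primrec.option_isSome.comp (Code.primrec_evaln.comp
    (Primrec.pair (Primrec.pair hs ((Primrec.ofNat Code).comp hq))
      (Primrec.encode.comp hσ)))) (Primrec.const true)

theorem mem_piClass {q : ℕ} {Z : ℕ → Bool} : Z ∈ piClass q ↔ ∀ n, initSeg Z n ∉ ceStrings q := by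
  simp [piClass, openOf]

/-- The parameter theorem for indices of c.e. sets of strings. -/
theorem exists_index {α : Type*} [Primcodable α] {p : α × List Bool → Prop} (hp : REPred p) :
    ∃ idx : α → ℕ, Primrec idx ∧ ∀ a σ, σ ∈ ceStrings (idx a) ↔ p (a, σ) := by
  obtain ⟨c, hc⟩ := Code.exists_code.1 hp
  refine ⟨fun a => encode (Code.curry c (encode a)),
    Primrec.encode.comp (Code.primrec₂_curry.comp (Primrec.const c) Primrec.encode), fun a σ => ?_⟩
  have h : p (a, σ) ↔ (Code.eval c (encode (a, σ))).Dom := by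
    rw [hc]; simp [Part.assert]
  rw [h, Part.dom_iff_mem]
  simp only [ceStrings, EnumBy, Set.mem_ofPred_eq, ofNat_encode, Option.isSome_iff_exists]
  rw [exists_comm]
  refine exists_congr fun x => ?_
  rw [encode_prod_val, ← Code.eval_curry, Code.evaln_complete]
  rfl

theorem rePred_section {α β : Type*} [Primcodable α] [Primcodable β] {p : α × β → Prop}
    (hp : REPred p) (a : α) : REPred fun b => p (a, b) := by
  obtain ⟨R, hR, h⟩ := rePred_iff_exists_primrecRel.1 hp
  exact rePred_iff_exists_primrecRel.2 ⟨fun b => R (a, b),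
    hR.comp (Primrec.pair (Primrec.const a) Primrec.fst) Primrec.snd, fun b => h _⟩

theorem IsPi01Class.diff_openOf {S : Set (ℕ → Bool)} {V : Set (List Bool)} (hS : IsPi01Class S)
    (hV : REPred fun σ => σ ∈ V) : IsPi01Class (S \ openOf V) := by
  obtain ⟨W, hW, rfl⟩ := hS
  obtain ⟨R, hR, hRW⟩ := rePred_iff_exists_primrecRel.1 hW
  obtain ⟨T, hT, hTV⟩ := rePred_iff_exists_primrecRel.1 hV
  refine ⟨W ∪ V, rePred_iff_exists_primrecRel.2
    ⟨fun σ s => R σ s ∨ T σ s, hR.or hT, fun σ => ?_⟩, ?_⟩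
  · rw [Set.mem_union, hRW, hTV, exists_or]
  · ext Z
    simp [openOf, forall_and]

theorem exists_piClass_eq {S : Set (ℕ → Bool)} (hS : IsPi01Class S) : ∃ q, piClass q = S := by
  obtain ⟨W, hW, rfl⟩ := hS
  obtain ⟨idx, -, h⟩ := exists_index (α := Unit) (p := fun x => x.2 ∈ W) (by
    obtain ⟨R, hR, h⟩ := rePred_iff_exists_primrecRel.1 hW
    exact rePred_iff_exists_primrecRel.2 ⟨fun x => R x.2,
      hR.comp (Primrec.snd.comp Primrec.fst) Primrec.snd, fun x => h _⟩)
  refine ⟨idx (), ?_⟩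
  have : ceStrings (idx ()) = W := Set.ext fun σ => h () σ
  rw [piClass, this]

/-! ### Emptiness of `Π⁰₁` classes -/

/-- At stage `s` it is seen that the `q`-th `Π⁰₁` class is empty: every string of length `s` has an
initial segment that is enumerated within `s` steps. -/
def SeenEmpty (q s : ℕ) : Prop :=
  ∀ σ ∈ strings s, ∃ i < s + 1, EnumBy q (σ.take i) s

theorem primrec_seenEmpty {α : Type*} [Primcodable α] {q s : α → ℕ}
    (hq : Primrec q) (hs : Primrec s) : PrimrecPred fun a => SeenEmpty (q a) (s a) := by
  have h1 : PrimrecPred fun x : (List Bool × (ℕ × ℕ)) =>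
      ∃ i < x.2.2 + 1, EnumBy x.2.1 (x.1.take i) x.2.2 := by
    refine primrecPred_exists_lt (R := fun (x : List Bool × (ℕ × ℕ)) i =>
      EnumBy x.2.1 (x.1.take i) x.2.2)
      (Primrec.succ.comp (Primrec.snd.comp Primrec.snd)) ?_
    exact primrec_enumBy (Primrec.fst.comp (Primrec.snd.comp Primrec.fst))
      (Primrec.list_take.comp Primrec.snd (Primrec.fst.comp Primrec.fst))
      (Primrec.snd.comp (Primrec.snd.comp Primrec.fst))
  exact (PrimrecRel.forall_mem_list (R := fun (σ : List Bool) (x : ℕ × ℕ) =>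
    ∃ i < x.2 + 1, EnumBy x.1 (σ.take i) x.2) h1).comp
    (primrec_strings.comp hs) (Primrec.pair hq hs)

theorem SeenEmpty.mono {q s t : ℕ} (h : SeenEmpty q s) (hst : s ≤ t) : SeenEmpty q t := by
  intro σ hσ
  obtain ⟨i, hi, he⟩ := h (σ.take s) (mem_strings.2 (by simp [mem_strings.1 hσ, hst]))
  refine ⟨i, by omega, ?_⟩
  rw [List.take_take, min_eq_left (by omega)] at he
  exact he.mono hst

theorem SeenEmpty.piClass_eq_empty {q s : ℕ} (h : SeenEmpty q s) : piClass q = ∅ := by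
  refine Set.eq_empty_of_forall_notMem fun Z hZ => ?_
  obtain ⟨i, hi, he⟩ := h _ (initSeg_mem_strings Z s)
  rw [take_initSeg Z (by omega)] at he
  exact mem_piClass.1 hZ i ⟨s, he⟩

theorem isOpen_setOf_initSeg (n : ℕ) (p : List Bool → Prop) :
    IsOpen {Z : ℕ → Bool | p (initSeg Z n)} := by
  have hc : Continuous fun Z : ℕ → Bool => fun i : Fin n => Z i :=
    continuous_pi fun i => continuous_apply _
  have : {Z : ℕ → Bool | p (initSeg Z n)} =
      (fun Z : ℕ → Bool => fun i : Fin n => Z i) ⁻¹' {f | p (List.ofFn f)} := by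
    ext Z
    have : initSeg Z n = List.ofFn fun i : Fin n => Z i := by
      refine List.ext_getElem (by simp) fun i h₁ h₂ => ?_
      simp [initSeg]
    simp [this]
  rw [this]
  exact (isOpen_discrete _).preimage hc

theorem isOpen_openOf (W : Set (List Bool)) : IsOpen (openOf W) := by
  have : openOf W = ⋃ n, {Z | initSeg Z n ∈ W} := by ext; simp [openOf]
  rw [this]
  exact isOpen_iUnion fun n => isOpen_setOf_initSeg n (· ∈ W)

theorem isClosed_piClass (q : ℕ) : IsClosed (piClass q) :=
  (isOpen_openOf _).isClosed_compl

/-- By compactness of Cantor space, emptiness of a `Π⁰₁` class is seen at some stage. -/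
theorem exists_seenEmpty {q : ℕ} (h : piClass q = ∅) : ∃ s, SeenEmpty q s := by
  have hcov : (Set.univ : Set (ℕ → Bool)) ⊆
      ⋃ s, {Z | ∃ i < s + 1, EnumBy q ((initSeg Z s).take i) s} := by
    intro Z _
    have : Z ∉ piClass q := by simp [h]
    simp only [mem_piClass, not_forall, not_not] at this
    obtain ⟨n, t, ht⟩ := this
    refine Set.mem_iUnion.2 ⟨max n t, n, by omega, ?_⟩
    rw [take_initSeg Z (le_max_left _ _)]
    exact ht.mono (le_max_right _ _)
  obtain ⟨s, hs⟩ := isCompact_univ.elim_directed_cover _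
    (fun s => isOpen_setOf_initSeg s fun σ => ∃ i < s + 1, EnumBy q (σ.take i) s) hcov (by
      refine Monotone.directed_le fun s t hst Z hZ => ?_
      obtain ⟨i, hi, he⟩ := hZ
      refine ⟨i, by omega, ?_⟩
      rw [take_initSeg Z (by omega)] at he ⊢
      exact he.mono hst)
  refine ⟨s, fun σ hσ => ?_⟩
  obtain ⟨i, hi, he⟩ := hs (Set.mem_univ fun i => σ.getD i false)
  rw [← mem_strings.1 hσ, initSeg_getD, mem_strings.1 hσ] at he
  exact ⟨i, hi, he⟩

theorem piClass_eq_empty_iff {q : ℕ} : piClass q = ∅ ↔ ∃ s, SeenEmpty q s :=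
  ⟨exists_seenEmpty, fun ⟨_, h⟩ => h.piClass_eq_empty⟩

end Cantor

namespace Cantor

open Nat.Partrec (Code)
open Encodable Denumerable Filter

/-! ### Oracle computations from finite initial segments -/

/-- Looking up a position in a finite oracle. -/
def lookup (x : ℕ) : Option ℕ :=
  ((decode (α := List Bool) x.unpair.1).bind fun σ => σ[x.unpair.2]?).map Bool.toNat

theorem primrec_lookup : Primrec lookup := by
  refine Primrec.option_map (Primrec.option_bind
    (Primrec.decode.comp (Primrec.fst.comp Primrec.unpair)) ?_)
    ((Primrec.dom_bool Bool.toNat).comp Primrec.snd)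
  exact Primrec.list_getElem?.comp Primrec.snd
    (Primrec.snd.comp (Primrec.unpair.comp Primrec.fst))

theorem exists_lookupCode : ∃ c : Code, ∀ x, Code.eval c x = (lookup x : Part ℕ) := by
  obtain ⟨c, hc⟩ := Code.exists_code.1 (Partrec.nat_iff.1 (primrec_lookup.to_comp.ofOption))
  exact ⟨c, fun x => by rw [hc]⟩

/-- A program without oracle that looks up a position in a finite oracle. -/
noncomputable def lookupCode : Code :=
  exists_lookupCode.choose

/-- A program sending `⟨⟨a, b⟩, x⟩` to `⟨a, ⟨b, x⟩⟩`. -/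
def assocCode : Code :=
  .pair (.comp .left .left) (.pair (.comp .right .left) .right)

/-- Translation of an oracle program into a program without oracle, whose input is a pair of a
finite oracle and the actual input; the computation diverges if it asks beyond the finite oracle. -/
noncomputable def toCode : OCode → Code
  | .zero => .zero
  | .succ => .comp .succ .right
  | .left => .comp .left .right
  | .right => .comp .right .right
  | .oracle => lookupCode
  | .pair c d => .pair (toCode c) (toCode d)
  | .comp c d => .comp (toCode c) (.pair .left (toCode d))
  | .prec c d => .comp (.prec (toCode c) (.comp (toCode d) assocCode))
      (.pair (.pair .left (.comp .left .right)) (.comp .right .right))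
  | .rfind c => .comp (.rfind' (.comp (toCode c) assocCode)) (.pair Code.id .zero)

section Eval

variable (c d : Code) (n : ℕ)

theorem evalCode_zero : Code.eval .zero n = Part.some 0 := rfl

theorem evalCode_succ : Code.eval .succ n = Part.some (n + 1) := rfl

theorem evalCode_left : Code.eval .left n = Part.some n.unpair.1 := rfl

theorem evalCode_right : Code.eval .right n = Part.some n.unpair.2 := rfl

theorem evalCode_comp : Code.eval (.comp c d) n = (Code.eval d n).bind fun x => Code.eval c x := rfl

theorem evalCode_pair : Code.eval (.pair c d) n =
    (Code.eval c n).bind fun x => (Code.eval d n).bind fun y => Part.some (Nat.pair x y) := by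
  simp [Code.eval, Seq.seq, Part.bind_some_eq_map]

end Eval

theorem eval_assocCode (a b x : ℕ) : Code.eval assocCode (Nat.pair (Nat.pair a b) x) =
    Part.some (Nat.pair a (Nat.pair b x)) := by
  simp [assocCode, evalCode_comp, evalCode_pair, evalCode_left, evalCode_right]

theorem eval_toCode_pair (c d : OCode) (a n : ℕ) :
    Code.eval (toCode (.pair c d)) (Nat.pair a n) =
      (Code.eval (toCode c) (Nat.pair a n)).bind fun x =>
        (Code.eval (toCode d) (Nat.pair a n)).bind fun y => Part.some (Nat.pair x y) :=
  evalCode_pair _ _ _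

theorem eval_toCode_comp (c d : OCode) (a n : ℕ) :
    Code.eval (toCode (.comp c d)) (Nat.pair a n) =
      (Code.eval (toCode d) (Nat.pair a n)).bind fun x =>
        Code.eval (toCode c) (Nat.pair a x) := by
  simp [toCode, evalCode_comp, evalCode_pair, evalCode_left, Part.bind_assoc]

theorem eval_toCode_prec (c d : OCode) (a b m : ℕ) :
    Code.eval (toCode (.prec c d)) (Nat.pair a (Nat.pair b m)) =
      Nat.rec (Code.eval (toCode c) (Nat.pair a b)) (fun y (IH : Part ℕ) => IH.bind fun i =>
        Code.eval (toCode d) (Nat.pair a (Nat.pair b (Nat.pair y i)))) m := by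
  have h : Code.eval (toCode (.prec c d)) (Nat.pair a (Nat.pair b m)) =
      Code.eval (.prec (toCode c) (.comp (toCode d) assocCode))
        (Nat.pair (Nat.pair a b) m) := by
    simp [toCode, evalCode_comp, evalCode_pair, evalCode_left, evalCode_right]
  rw [h]
  clear h
  induction m with
  | zero => exact Code.eval_prec_zero _ _ _
  | succ m ih =>
    rw [Code.eval_prec_succ, ih]
    simp [evalCode_comp, eval_assocCode]

theorem mem_rfind_map_zero {f : ℕ → Part ℕ} {y : ℕ} :
    y ∈ Nat.rfind (fun m => (fun x => decide (x = 0)) <$> f m) ↔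
      0 ∈ f y ∧ ∀ m < y, ∃ x ∈ f m, x ≠ 0 := by
  refine Nat.mem_rfind.trans ?_
  simp [Part.mem_map_iff]

theorem mem_eval_toCode_rfind (c : OCode) (a n y : ℕ) :
    y ∈ Code.eval (toCode (.rfind c)) (Nat.pair a n) ↔
      0 ∈ Code.eval (toCode c) (Nat.pair a (Nat.pair n y)) ∧
        ∀ m < y, ∃ x ∈ Code.eval (toCode c) (Nat.pair a (Nat.pair n m)), x ≠ 0 := by
  have h : Code.eval (toCode (.rfind c)) (Nat.pair a n) =
      Code.eval (.rfind' (.comp (toCode c) assocCode)) (Nat.pair (Nat.pair a n) 0) := by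
    simp [toCode, evalCode_comp, evalCode_pair, evalCode_zero, Code.eval_id]
  have hr : ∀ f b, y ∈ Code.eval (.rfind' f) (Nat.pair b 0) ↔
      y ∈ Nat.rfind fun m => (fun x => decide (x = 0)) <$> Code.eval f (Nat.pair b m) := by
    simp [Code.eval]
  have hc : ∀ m, Code.eval (.comp (toCode c) assocCode) (Nat.pair (Nat.pair a n) m) =
      Code.eval (toCode c) (Nat.pair a (Nat.pair n m)) := by
    simp [evalCode_comp, eval_assocCode]
  rw [h, hr]
  refine mem_rfind_map_zero.trans ?_
  simp only [hc]

theorem mem_evalO_rfind (Z : ℕ → Bool) (c : OCode) (n y : ℕ) :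
    y ∈ OCode.eval Z (.rfind c) n ↔ 0 ∈ OCode.eval Z c (Nat.pair n y) ∧
      ∀ m < y, ∃ x ∈ OCode.eval Z c (Nat.pair n m), x ≠ 0 :=
  mem_rfind_map_zero

theorem evalO_pair (Z : ℕ → Bool) (c d : OCode) (n : ℕ) : OCode.eval Z (.pair c d) n =
    (OCode.eval Z c n).bind fun x =>
      (OCode.eval Z d n).bind fun y => Part.some (Nat.pair x y) := by
  simp [OCode.eval, Seq.seq, Part.bind_some_eq_map]

theorem evalO_prec (Z : ℕ → Bool) (c d : OCode) (a m : ℕ) :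
    OCode.eval Z (.prec c d) (Nat.pair a m) =
      Nat.rec (OCode.eval Z c a) (fun y (IH : Part ℕ) => IH.bind fun i =>
        OCode.eval Z d (Nat.pair a (Nat.pair y i))) m := by
  simp [OCode.eval]

theorem eval_toCode_oracle (a n : ℕ) :
    Code.eval (toCode .oracle) (Nat.pair a n) = (lookup (Nat.pair a n) : Part ℕ) :=
  exists_lookupCode.choose_spec _

theorem lookup_initSeg (Z : ℕ → Bool) (s n : ℕ) :
    lookup (Nat.pair (encode (initSeg Z s)) n) = if n < s then some (Z n).toNat else none := by
  split_ifs with h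
  · simp [lookup, getElem?_initSeg Z h]
  · simpa [lookup] using h

/-- A computation from an initial segment of the oracle is a computation from the oracle. -/
theorem mem_eval_of_mem_eval_toCode {Z : ℕ → Bool} {s : ℕ} {c : OCode} {n y : ℕ}
    (h : y ∈ Code.eval (toCode c) (Nat.pair (encode (initSeg Z s)) n)) : y ∈ OCode.eval Z c n := by
  induction c generalizing n y with
  | zero => simpa [toCode, OCode.eval, evalCode_comp, evalCode_zero, evalCode_succ, evalCode_left,
      evalCode_right] using h
  | succ => simpa [toCode, OCode.eval, evalCode_comp, evalCode_zero, evalCode_succ, evalCode_left,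
      evalCode_right] using h
  | left => simpa [toCode, OCode.eval, evalCode_comp, evalCode_zero, evalCode_succ, evalCode_left,
      evalCode_right] using h
  | right => simpa [toCode, OCode.eval, evalCode_comp, evalCode_zero, evalCode_succ, evalCode_left,
      evalCode_right] using h
  | oracle =>
    rw [eval_toCode_oracle, lookup_initSeg] at h
    split_ifs at h with hn
    · simpa [OCode.eval, char] using h
    · simp at h
  | pair c d hc hd =>
    rw [eval_toCode_pair] at h
    rw [evalO_pair]
    simp only [Part.mem_bind_iff] at h ⊢
    obtain ⟨u, hu, v, hv, h⟩ := h
    exact ⟨u, hc hu, v, hd hv, h⟩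
  | comp c d hc hd =>
    rw [eval_toCode_comp] at h
    obtain ⟨x, hx, hy⟩ := Part.mem_bind_iff.1 h
    exact Part.mem_bind_iff.2 ⟨x, hd hx, hc hy⟩
  | prec c d hc hd =>
    obtain ⟨⟨b, m⟩, rfl⟩ := Nat.pairEquiv.surjective n
    simp only [Nat.pairEquiv_apply, Function.uncurry] at h ⊢
    rw [eval_toCode_prec] at h
    rw [evalO_prec]
    induction m generalizing y with
    | zero => exact hc h
    | succ m ih =>
      obtain ⟨x, hx, hy⟩ := Part.mem_bind_iff.1 h
      exact Part.mem_bind_iff.2 ⟨x, ih hx, hd hy⟩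
  | rfind c hc =>
    rw [mem_eval_toCode_rfind] at h
    rw [mem_evalO_rfind]
    refine ⟨hc h.1, fun m hm => ?_⟩
    obtain ⟨x, hx, h0⟩ := h.2 m hm
    exact ⟨x, hc hx, h0⟩

/-- The use principle: a computation uses only an initial segment of the oracle. -/
theorem eventually_mem_eval_toCode {Z : ℕ → Bool} {c : OCode} {n y : ℕ}
    (h : y ∈ OCode.eval Z c n) :
    ∀ᶠ s in atTop, y ∈ Code.eval (toCode c) (Nat.pair (encode (initSeg Z s)) n) := by
  induction c generalizing n y with
  | zero => exact Eventually.of_forall fun s => by simpa [toCode, OCode.eval, evalCode_comp,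
      evalCode_zero, evalCode_succ, evalCode_left, evalCode_right] using h
  | succ => exact Eventually.of_forall fun s => by simpa [toCode, OCode.eval, evalCode_comp,
      evalCode_zero, evalCode_succ, evalCode_left, evalCode_right] using h
  | left => exact Eventually.of_forall fun s => by simpa [toCode, OCode.eval, evalCode_comp,
      evalCode_zero, evalCode_succ, evalCode_left, evalCode_right] using h
  | right => exact Eventually.of_forall fun s => by simpa [toCode, OCode.eval, evalCode_comp,
      evalCode_zero, evalCode_succ, evalCode_left, evalCode_right] using h
  | oracle =>
    filter_upwards [eventually_gt_atTop n] with s hs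
    rw [eval_toCode_oracle, lookup_initSeg, if_pos hs]
    simpa [OCode.eval, char] using h
  | pair c d hc hd =>
    rw [evalO_pair] at h
    simp only [Part.mem_bind_iff] at h
    obtain ⟨u, hu, v, hv, h⟩ := h
    filter_upwards [hc hu, hd hv] with s h1 h2
    rw [eval_toCode_pair]
    simp only [Part.mem_bind_iff]
    exact ⟨u, h1, v, h2, h⟩
  | comp c d hc hd =>
    obtain ⟨x, hx, hy⟩ := Part.mem_bind_iff.1 h
    filter_upwards [hd hx, hc hy] with s h1 h2
    rw [eval_toCode_comp]
    exact Part.mem_bind_iff.2 ⟨x, h1, h2⟩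
  | prec c d hc hd =>
    obtain ⟨⟨b, m⟩, rfl⟩ := Nat.pairEquiv.surjective n
    simp only [Nat.pairEquiv_apply, Function.uncurry] at h ⊢
    rw [evalO_prec] at h
    simp only [eval_toCode_prec]
    induction m generalizing y with
    | zero => exact hc h
    | succ m ih =>
      obtain ⟨x, hx, hy⟩ := Part.mem_bind_iff.1 h
      filter_upwards [ih hx, hd hy] with s h1 h2
      exact Part.mem_bind_iff.2 ⟨x, h1, h2⟩
  | rfind c hc =>
    rw [mem_evalO_rfind] at h
    choose! x hx h0 using h.2
    filter_upwards [hc h.1, (eventually_all_finset (Finset.range y)).2 fun m hm =>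
      hc (hx m (Finset.mem_range.1 hm))] with s h1 h2
    rw [mem_eval_toCode_rfind]
    exact ⟨h1, fun m hm => ⟨x m, h2 m (Finset.mem_range.2 hm), h0 m hm⟩⟩

/-- One step of the course-of-values recursion computing the translation of the `n`-th oracle
program, from the list of the translations of the previous ones. -/
noncomputable def toCodeStep (L : List Code) : Option Code :=
  if L.length < 5 then
    some ([Code.zero, .comp .succ .right, .comp .left .right, .comp .right .right,
      lookupCode].getD L.length .zero)
  else
    let m := (L.length - 5) / 4
    let c := L.getD m.unpair.1 .zero
    let d := L.getD m.unpair.2 .zero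
    if (L.length - 5) % 4 = 0 then some (.pair c d)
    else if (L.length - 5) % 4 = 1 then some (.comp c (.pair .left d))
    else if (L.length - 5) % 4 = 2 then some (.comp (.prec c (.comp d assocCode))
      (.pair (.pair .left (.comp .left .right)) (.comp .right .right)))
    else some (.comp (.rfind' (.comp (L.getD m .zero) assocCode)) (.pair Code.id .zero))

theorem primrec_toCodeStep : Primrec toCodeStep := by
  have hn : Primrec fun L : List Code => L.length := Primrec.list_length
  have hk : Primrec fun L : List Code => L.length - 5 :=
    Primrec.nat_sub.comp hn (Primrec.const 5)
  have hm : Primrec fun L : List Code => (L.length - 5) / 4 :=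
    Primrec.nat_div.comp hk (Primrec.const 4)
  have hr : Primrec fun L : List Code => (L.length - 5) % 4 :=
    Primrec.nat_mod.comp hk (Primrec.const 4)
  have hc : Primrec fun L : List Code => L.getD ((L.length - 5) / 4).unpair.1 .zero :=
    (Primrec.list_getD Code.zero).comp Primrec.id (Primrec.fst.comp (Primrec.unpair.comp hm))
  have hd : Primrec fun L : List Code => L.getD ((L.length - 5) / 4).unpair.2 .zero :=
    (Primrec.list_getD Code.zero).comp Primrec.id (Primrec.snd.comp (Primrec.unpair.comp hm))
  have he : Primrec fun L : List Code => L.getD ((L.length - 5) / 4) .zero :=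
    (Primrec.list_getD Code.zero).comp Primrec.id hm
  refine Primrec.ite (Primrec.nat_lt.comp hn (Primrec.const 5))
    (Primrec.option_some.comp ((Primrec.list_getD Code.zero).comp (Primrec.const _) hn)) ?_
  refine Primrec.ite (Primrec.eq.comp hr (Primrec.const 0))
    (Primrec.option_some.comp (Code.primrec₂_pair.comp hc hd)) ?_
  refine Primrec.ite (Primrec.eq.comp hr (Primrec.const 1))
    (Primrec.option_some.comp (Code.primrec₂_comp.comp hc
      (Code.primrec₂_pair.comp (Primrec.const Code.left) hd))) ?_
  refine Primrec.ite (Primrec.eq.comp hr (Primrec.const 2))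
    (Primrec.option_some.comp (Code.primrec₂_comp.comp (Code.primrec₂_prec.comp hc
      (Code.primrec₂_comp.comp hd (Primrec.const _))) (Primrec.const _))) ?_
  exact Primrec.option_some.comp (Code.primrec₂_comp.comp (Code.primrec_rfind'.comp
    (Code.primrec₂_comp.comp he (Primrec.const _))) (Primrec.const _))

theorem toCodeStep_map_range (n : ℕ) :
    toCodeStep ((List.range n).map fun i => toCode (OCode.ofNat i)) =
      some (toCode (OCode.ofNat n)) := by
  rcases lt_or_ge n 5 with h | h
  · interval_cases n <;> simp [toCodeStep, OCode.ofNat, toCode]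
  · obtain ⟨n, rfl⟩ := Nat.exists_eq_add_of_le' h
    have h0 : n / 4 < n + 5 := by omega
    have h1 : (n / 4).unpair.1 < n + 5 := lt_of_le_of_lt (Nat.unpair_left_le _) h0
    have h2 : (n / 4).unpair.2 < n + 5 := lt_of_le_of_lt (Nat.unpair_right_le _) h0
    have hmod : n % 4 < 4 := Nat.mod_lt _ (by norm_num)
    rw [OCode.ofNat]
    simp only [toCodeStep, List.length_map, List.length_range, Nat.add_sub_cancel]
    rw [if_neg (by omega)]
    generalize hr : n % 4 = r at hmod
    interval_cases r <;> simp [List.getD, h0, h1, h2, toCode]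

/-- The translation of oracle programs is computable in terms of their numbers. -/
theorem primrec_toCode_ofNat : Primrec fun e => toCode (OCode.ofNat e) := by
  have := Primrec.nat_strong_rec (fun (_ : Unit) n => toCode (OCode.ofNat n))
    (g := fun _ L => toCodeStep L) (primrec_toCodeStep.comp Primrec.snd)
    (fun _ n => toCodeStep_map_range n)
  exact this.comp (Primrec.const ()) Primrec.id

/-- Within `t` steps, the `e`-th program with the finite oracle `σ` returns `0` on input `n`. -/
def ReturnsZero (e n : ℕ) (σ : List Bool) (t : ℕ) : Prop :=
  Code.evaln t (toCode (OCode.ofNat e)) (Nat.pair (encode σ) n) = some 0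

theorem primrec_returnsZero {α : Type*} [Primcodable α] {e n t : α → ℕ} {σ : α → List Bool}
    (he : Primrec e) (hn : Primrec n) (hσ : Primrec σ) (ht : Primrec t) :
    PrimrecPred fun a => ReturnsZero (e a) (n a) (σ a) (t a) :=
  Primrec.eq.comp (Code.primrec_evaln.comp (Primrec.pair
    (Primrec.pair ht (primrec_toCode_ofNat.comp he))
    (Primrec₂.natPair.comp (Primrec.encode.comp hσ) hn))) (Primrec.const (some 0))

theorem ReturnsZero.mem_phi {e n s t : ℕ} {Z : ℕ → Bool}
    (h : ReturnsZero e n (initSeg Z s) t) : 0 ∈ Phi e Z n :=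
  mem_eval_of_mem_eval_toCode (Code.evaln_sound h)

theorem eventually_returnsZero {e n : ℕ} {Z : ℕ → Bool} (h : 0 ∈ Phi e Z n) :
    ∀ᶠ s in atTop, ∃ t, ReturnsZero e n (initSeg Z s) t := by
  filter_upwards [eventually_mem_eval_toCode h] with s hs
  exact Code.evaln_complete.1 hs

end Cantor

namespace Cantor

open Nat.Partrec (Code)
open Encodable Denumerable

/-! ### Queries to the jump -/

theorem exists_oCode {f : ℕ →. ℕ} (hf : Nat.Partrec f) : ∃ c : OCode, ∀ Z, OCode.eval Z c = f := by
  induction hf with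
  | zero => exact ⟨.zero, fun _ => rfl⟩
  | succ => exact ⟨.succ, fun _ => rfl⟩
  | left => exact ⟨.left, fun _ => rfl⟩
  | right => exact ⟨.right, fun _ => rfl⟩
  | pair _ _ h1 h2 =>
    obtain ⟨c, hc⟩ := h1; obtain ⟨d, hd⟩ := h2
    exact ⟨.pair c d, fun Z => by rw [← hc Z, ← hd Z]; rfl⟩
  | comp _ _ h1 h2 =>
    obtain ⟨c, hc⟩ := h1; obtain ⟨d, hd⟩ := h2
    exact ⟨.comp c d, fun Z => by rw [← hc Z, ← hd Z]; rfl⟩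
  | prec _ _ h1 h2 =>
    obtain ⟨c, hc⟩ := h1; obtain ⟨d, hd⟩ := h2
    exact ⟨.prec c d, fun Z => by rw [← hc Z, ← hd Z]; rfl⟩
  | rfind _ h1 =>
    obtain ⟨c, hc⟩ := h1
    exact ⟨.rfind c, fun Z => by rw [← hc Z]; rfl⟩

/-- An oracle program returning the constant `n`. -/
def constCode : ℕ → OCode
  | 0 => .zero
  | n + 1 => .comp .succ (constCode n)

theorem eval_constCode (Z : ℕ → Bool) (n m : ℕ) :
    OCode.eval Z (constCode n) m = Part.some n := by
  induction n with
  | zero => rfl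
  | succ n ih => simp [constCode, OCode.eval, ih]

theorem primrec_toNat_constCode : Primrec fun n => OCode.toNat (constCode n) := by
  have h := Primrec.nat_rec₁ (f := fun _ (x : ℕ) => 4 * Nat.pair 1 x + 6) 0
    (Primrec.nat_add.comp (Primrec.nat_mul.comp (Primrec.const 4)
      (Primrec₂.natPair.comp (Primrec.const 1) Primrec.snd)) (Primrec.const 6))
  refine h.of_eq fun n => ?_
  induction n with
  | zero => rfl
  | succ n ih => simp only [constCode, OCode.toNat, ih]

theorem jump_eq_true_iff (Z : ℕ → Bool) (e : ℕ) :
    jump Z e = true ↔ (Phi e Z e : Part ℕ).Dom := by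
  classical
  exact decide_eq_true_iff

/-- The jump answers halting questions about a fixed program on a given input. -/
theorem exists_jump_query_dom (c : OCode) :
    ∃ r : ℕ → ℕ, Primrec r ∧ ∀ Z n, jump Z (r n) = true ↔ (OCode.eval Z c n).Dom := by
  refine ⟨fun n => OCode.toNat (.comp c (constCode n)), ?_, fun Z n => ?_⟩
  · exact Primrec.nat_add.comp (Primrec.nat_mul.comp (Primrec.const 4)
      (Primrec₂.natPair.comp (Primrec.const _) primrec_toNat_constCode)) (Primrec.const 6)
  · have h : ∀ m, Phi (OCode.toNat (.comp c (constCode n))) Z m = OCode.eval Z c n := by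
      intro m
      rw [Phi, OCode.ofNat_toNat]
      simp only [OCode.eval, eval_constCode]
      exact Part.bind_some _ _
    exact (jump_eq_true_iff Z _).trans (by rw [h])

theorem exists_jump_query_re {α : Type*} [Primcodable α] {p : α → Prop} (hp : REPred p) :
    ∃ r : α → ℕ, Primrec r ∧ ∀ Z a, jump Z (r a) = true ↔ p a := by
  obtain ⟨c, hc⟩ := exists_oCode hp
  obtain ⟨r, hr, h⟩ := exists_jump_query_dom c
  refine ⟨fun a => r (encode a), hr.comp Primrec.encode, fun Z a => ?_⟩
  rw [h, hc]
  simp [Part.assert]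

theorem exists_jump_query_mem :
    ∃ r : ℕ → ℕ, Primrec r ∧ ∀ Z n, jump Z (r n) = Z n := by
  have ht : Nat.Partrec fun n => ((if n = 0 then none else some 0 : Option ℕ) : Part ℕ) :=
    Partrec.nat_iff.1 (Computable.ofOption (Primrec.ite (Primrec.eq.comp Primrec.id
      (Primrec.const 0)) (Primrec.const none) (Primrec.const (some 0))).to_comp)
  obtain ⟨c, hc⟩ := exists_oCode ht
  obtain ⟨r, hr, h⟩ := exists_jump_query_dom (.comp c .oracle)
  refine ⟨r, hr, fun Z n => Bool.eq_iff_iff.2 ?_⟩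
  have : OCode.eval Z (.comp c .oracle) n = OCode.eval Z c (Z n).toNat := Part.bind_some _ _
  rw [h, this, hc]
  cases Z n <;> simp

/-! ### Truth-table computability -/

theorem le_sum_map {β : Type*} {L : List β} {g : β → ℕ} {b : β} (hb : b ∈ L) :
    g b ≤ (L.map g).sum :=
  List.le_sum_of_mem (List.mem_map_of_mem hb)

section

variable {α β γ : Type*} [Primcodable α] [Primcodable β] [Primcodable γ] {A : ℕ → Bool}

theorem primrec_sum_map {L : α → List β} {g : α → β → ℕ} (hL : Primrec L) (hg : Primrec₂ g) :
    Primrec fun a => ((L a).map (g a)).sum := by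
  have h := Primrec.list_foldr (h := fun (_ : α) (p : ℕ × ℕ) => p.1 + p.2)
    (Primrec.list_map hL hg) (Primrec.const 0)
    (Primrec.nat_add.comp (Primrec.fst.comp Primrec.snd) (Primrec.snd.comp Primrec.snd))
  exact h.of_eq fun a => rfl

/-- `f` is computed by a total procedure from initial segments of `A` of computably bounded
length: truth-table computability of `f` in `A`, except that only primitive recursive procedures
and bounds are allowed. -/
def TTComputable (A : ℕ → Bool) (f : α → β) : Prop :=
  ∃ (u : α → ℕ) (g : α → List Bool → β), Primrec u ∧ Primrec₂ g ∧
    ∀ a, ∀ v ≥ u a, g a (initSeg A v) = f a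

namespace TTComputable

theorem query {r : α → ℕ} (hr : Primrec r) : TTComputable A fun a => A (r a) :=
  ⟨fun a => r a + 1, fun a σ => σ.getD (r a) false, Primrec.succ.comp hr,
    (Primrec.list_getD false).comp Primrec.snd (hr.comp Primrec.fst),
    fun _ _ hv => getD_initSeg A hv⟩

theorem comp_primrec {f : β → γ} {h : α → β} (hf : TTComputable A f) (hh : Primrec h) :
    TTComputable A fun a => f (h a) := by
  obtain ⟨u, g, hu, hg, H⟩ := hf
  exact ⟨fun a => u (h a), fun a σ => g (h a) σ, hu.comp hh,
    hg.comp (hh.comp Primrec.fst) Primrec.snd, fun a v hv => H _ v hv⟩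

theorem map {f : α → β} {F : α → β → γ} (hF : Primrec₂ F) (hf : TTComputable A f) :
    TTComputable A fun a => F a (f a) := by
  obtain ⟨u, g, hu, hg, H⟩ := hf
  exact ⟨u, fun a σ => F a (g a σ), hu, hF.comp Primrec.fst hg,
    fun a v hv => congrArg (F a) (H a v hv)⟩

theorem pair {f : α → β} {h : α → γ} (hf : TTComputable A f) (hh : TTComputable A h) :
    TTComputable A fun a => (f a, h a) := by
  obtain ⟨u, g, hu, hg, H⟩ := hf
  obtain ⟨u', g', hu', hg', H'⟩ := hh
  refine ⟨fun a => max (u a) (u' a), fun a σ => (g a σ, g' a σ), Primrec.nat_max.comp hu hu',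
    Primrec.pair hg hg', fun a v hv => ?_⟩
  dsimp only
  rw [H a v (le_trans (le_max_left _ _) hv), H' a v (le_trans (le_max_right _ _) hv)]

/-- Composition: the use is bounded by considering all potential oracles for the inner
procedure. -/
theorem bind {f : α × β → γ} {h : α → β} (hf : TTComputable A f) (hh : TTComputable A h) :
    TTComputable A fun a => f (a, h a) := by
  obtain ⟨u, g, hu, hg, H⟩ := hf
  obtain ⟨u', g', hu', hg', H'⟩ := hh
  refine ⟨fun a => u' a + ((strings (u' a)).map fun σ => u (a, g' a σ)).sum,
    fun a σ => g (a, g' a σ) σ, ?_, ?_, fun a v hv => ?_⟩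
  · refine Primrec.nat_add.comp hu' (primrec_sum_map (primrec_strings.comp hu') ?_)
    exact hu.comp (Primrec.pair Primrec.fst hg')
  · exact hg.comp (Primrec.pair Primrec.fst hg') Primrec.snd
  · dsimp only at hv ⊢
    rw [H' a v (by omega)]
    refine H _ v ?_
    have := le_sum_map (g := fun σ => u (a, g' a σ)) (initSeg_mem_strings A (u' a))
    simp only [H' a _ le_rfl] at this
    omega

theorem list_map_range {f : α × ℕ → β} {n : α → ℕ} (hf : TTComputable A f) (hn : Primrec n) :
    TTComputable A fun a => (List.range (n a)).map fun i => f (a, i) := by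
  obtain ⟨u, g, hu, hg, H⟩ := hf
  refine ⟨fun a => ((List.range (n a)).map fun i => u (a, i)).sum,
    fun a σ => (List.range (n a)).map fun i => g (a, i) σ, ?_, ?_, fun a v hv => ?_⟩
  · exact primrec_sum_map (Primrec.list_range.comp hn) hu
  · refine Primrec.list_map (Primrec.list_range.comp (hn.comp Primrec.fst)) ?_
    exact hg.comp (Primrec.pair (Primrec.fst.comp Primrec.fst) Primrec.snd)
      (Primrec.snd.comp Primrec.fst)
  · refine List.map_congr_left fun i hi => H _ v (le_trans ?_ hv)
    exact le_sum_map (g := fun i => u (a, i)) hi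

/-- Iteration: the use is bounded by considering all potential values of the iterates. -/
theorem iterate {F : ℕ × β → β} (hF : TTComputable A F) {q : ℕ → β}
    (hq : ∀ e, q (e + 1) = F (e, q e)) : TTComputable A q := by
  obtain ⟨u, g, hu, hg, H⟩ := hF
  let L : ℕ → List β := fun e => Nat.rec [q 0]
    (fun i l => l.flatMap fun b => (strings (u (i, b))).map (g (i, b))) e
  have hL : Primrec L := by
    refine Primrec.nat_rec₁ (f := fun i (l : List β) =>
      l.flatMap fun b => (strings (u (i, b))).map (g (i, b))) [q 0] ?_
    refine Primrec.list_flatMap Primrec.snd ?_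
    have hp : Primrec fun x : (ℕ × List β) × β => (x.1.1, x.2) :=
      Primrec.pair (Primrec.fst.comp Primrec.fst) Primrec.snd
    exact Primrec.list_map (primrec_strings.comp (hu.comp hp))
      (hg.comp (hp.comp Primrec.fst) Primrec.snd)
  have hmem : ∀ e, q e ∈ L e := by
    intro e
    induction e with
    | zero => exact List.mem_singleton.2 rfl
    | succ e ih =>
      refine List.mem_flatMap.2 ⟨_, ih, List.mem_map.2 ⟨_, initSeg_mem_strings A _, ?_⟩⟩
      rw [H _ _ le_rfl, hq]
  refine ⟨fun e => ∑ i ∈ Finset.range e, ((L i).map fun b => u (i, b)).sum,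
    fun e σ => Nat.rec (q 0) (fun i b => g (i, b) σ) e, ?_, ?_, fun e v hv => ?_⟩
  · refine primrec_sum_range Primrec.id (primrec_sum_map (hL.comp Primrec.snd) ?_)
    exact hu.comp (Primrec.pair (Primrec.snd.comp Primrec.fst) Primrec.snd)
  · refine Primrec.nat_rec' (f := fun x : ℕ × List Bool => x.1) (g := fun _ => q 0)
      (h := fun x p => g (p.1, p.2) x.2) Primrec.fst (Primrec.const _) ?_
    exact hg.comp Primrec.snd (Primrec.snd.comp Primrec.fst)
  · have : ∀ i ≤ e, (Nat.rec (q 0) (fun i b => g (i, b) (initSeg A v)) i : β) = q i := by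
      intro i hi
      induction i with
      | zero => rfl
      | succ i ih =>
        show g (i, _) (initSeg A v) = _
        rw [ih (by omega), hq]
        refine H _ v (le_trans ?_ hv)
        refine (le_sum_map (g := fun b => u (i, b)) (hmem i)).trans ?_
        exact Finset.single_le_sum (f := fun i => ((L i).map fun b => u (i, b)).sum)
          (fun _ _ => Nat.zero_le _) (Finset.mem_range.2 hi)
    exact this e le_rfl

theorem ttReducible {G : ℕ → Bool} (h : TTComputable A G) : TTReducible G A := by
  obtain ⟨u, g, hu, hg, H⟩ := h
  refine ⟨fun n => (List.range (u n), (strings (u n)).filter fun σ => g n σ), ?_, fun n => ?_⟩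
  · refine (Primrec.pair (Primrec.list_range.comp hu) ?_).to_comp
    have hR : PrimrecRel fun (σ : List Bool) (n : ℕ) => g n σ = true :=
      Primrec.eq.comp (hg.comp Primrec.snd Primrec.fst) (Primrec.const true)
    exact (hR.listFilter.comp (primrec_strings.comp hu) Primrec.id).of_eq fun n => by simp
  · have hm : (List.range (u n)).map A = initSeg A (u n) := rfl
    simp only [TTCondition.Holds, hm, List.mem_filter, initSeg_mem_strings, true_and,
      H n _ le_rfl]

end TTComputable

end

end Cantor

namespace Cantor

open Encodable
open scoped ENNReal

/-! ### Cylinders and Kraft's inequality -/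

/-- The cylinder of all sequences extending the string `σ`. -/
def cylinder (σ : List Bool) : Set (ℕ → Bool) :=
  {Z | initSeg Z σ.length = σ}

theorem measurableSet_cylinder (σ : List Bool) : MeasurableSet (cylinder σ) :=
  (isOpen_setOf_initSeg σ.length (· = σ)).measurableSet

instance : MeasureTheory.IsProbabilityMeasure fairCoin := by
  unfold fairCoin; infer_instance

theorem fairCoin_cylinder (σ : List Bool) : fairCoin (cylinder σ) = 2⁻¹ ^ σ.length := by
  have h : cylinder σ =
      Set.pi (Finset.range σ.length : Set ℕ) fun i => {σ.getD i false} := by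
    ext Z
    simp only [cylinder, Set.mem_ofPred_eq, Set.mem_pi, Finset.coe_range, Set.mem_Iio,
      Set.mem_singleton_iff]
    constructor
    · intro h i hi
      rw [← h, getD_initSeg Z hi]
    · intro h
      exact (initSeg_congr h).trans (initSeg_getD σ)
  rw [h, fairCoin, MeasureTheory.Measure.infinitePi_pi _ fun i _ => MeasurableSet.of_discrete]
  have : ∀ b : Bool, (PMF.uniformOfFintype Bool).toMeasure {b} = 2⁻¹ := by
    intro b
    rw [PMF.toMeasure_apply_singleton _ _ (MeasurableSet.of_discrete)]
    simp
  simp [this]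

/-- The weight `2⁻ʳ` of a request for a description of length `r`; no request has weight `0`. -/
noncomputable def weight {α : Type*} : Option (ℕ × α) → ℝ≥0∞
  | none => 0
  | some p => 2⁻¹ ^ p.1

/-- Kraft's inequality, for a family of strings of which some may be missing. -/
theorem tsum_weight_le_one {ι α : Type*} [Countable ι] {d : ι → Option (ℕ × α)}
    {p : ι → List Bool} (hd : ∀ i x, d i = some x → x.1 = (p i).length)
    (hp : ∀ i j, (d i).isSome → (d j).isSome → p i <+: p j → i = j) :
    ∑' i, weight (d i) ≤ 1 := by
  classical
  let C : ι → Set (ℕ → Bool) := fun i => if (d i).isSome then cylinder (p i) else ∅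
  have hC : ∀ i, weight (d i) = fairCoin (C i) := by
    intro i
    cases h : d i with
    | none => simp [C, h, weight]
    | some x => simp [C, h, weight, fairCoin_cylinder, hd i x h]
  have hm : ∀ i, MeasurableSet (C i) := by
    intro i
    dsimp only [C]
    split_ifs
    exacts [measurableSet_cylinder _, MeasurableSet.empty]
  have hdisj : Pairwise (Function.onFun Disjoint C) := by
    intro i j hij
    refine Set.disjoint_left.2 fun Z hi hj => hij ?_
    by_cases h1 : (d i).isSome <;> by_cases h2 : (d j).isSome <;>
      simp only [C, h1, h2, if_true, if_false, Bool.false_eq_true, Set.mem_empty_iff_false] at hi hj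
    rcases le_total (p i).length (p j).length with h | h
    · refine hp i j h1 h2 ?_
      have h3 : initSeg Z (p j).length = p j := hj
      have h4 : initSeg Z (p i).length = p i := hi
      rw [← h3, ← h4, ← take_initSeg Z h]
      exact List.take_prefix _ _
    · refine (hp j i h2 h1 ?_).symm
      have h3 : initSeg Z (p j).length = p j := hj
      have h4 : initSeg Z (p i).length = p i := hi
      rw [← h3, ← h4, ← take_initSeg Z h]
      exact List.take_prefix _ _
  simp only [hC]
  rw [← MeasureTheory.measure_iUnion hdisj hm]
  exact MeasureTheory.prob_le_one

/-! ### Machines from requests -/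

/-- The binary expansion of `c` as a string of length `R`. -/
def bits (R c : ℕ) : List Bool :=
  (List.range R).map fun i => decide (c / 2 ^ (R - 1 - i) % 2 = 1)

@[simp] theorem length_bits (R c : ℕ) : (bits R c).length = R := by simp [bits]

theorem primrec_bits : Primrec₂ bits := by
  refine Primrec.list_map (Primrec.list_range.comp Primrec.fst) ?_
  refine (Primrec.eq.comp (Primrec.nat_mod.comp (Primrec.nat_div.comp
    (Primrec.snd.comp Primrec.fst) (primrec_nat_pow.comp (Primrec.const 2) ?_))
    (Primrec.const 2)) (Primrec.const 1)).decide
  exact Primrec.nat_sub.comp (Primrec.nat_sub.comp (Primrec.fst.comp Primrec.fst)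
    (Primrec.const 1)) Primrec.snd

theorem eq_div_of_bits_prefix {R S c d : ℕ} (hc : c < 2 ^ R) (hd : d < 2 ^ S)
    (h : bits R c <+: bits S d) : R ≤ S ∧ c = d / 2 ^ (S - R) := by
  have hRS : R ≤ S := by simpa using h.length_le
  refine ⟨hRS, Nat.eq_of_testBit_eq fun k => ?_⟩
  rw [Nat.testBit_div_two_pow]
  rcases lt_or_ge k R with hk | hk
  · have h1 := h.getElem (i := R - 1 - k) (by simp; omega)
    simp only [bits, List.getElem_map, List.getElem_range, ← Nat.testBit_eq_decide_div_mod_eq]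
      at h1
    rw [show R - 1 - (R - 1 - k) = k by omega,
      show S - 1 - (R - 1 - k) = k + (S - R) by omega] at h1
    exact h1
  · rw [Nat.testBit_lt_two_pow (hc.trans_le (Nat.pow_le_pow_right two_pos hk)),
      Nat.testBit_lt_two_pow (hd.trans_le (Nat.pow_le_pow_right two_pos (by omega)))]

section Requests

variable (req : ℕ → Option (ℕ × List Bool))

/-- The length asked for by the `i`-th request (`0` if there is none). -/
def reqLength (i : ℕ) : ℕ := ((req i).map Prod.fst).getD 0

/-- The numerator and the binary exponent of the total weight of the requests before `i`. -/
def partialWeight : ℕ → ℕ × ℕ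
  | 0 => (0, 0)
  | i + 1 => ((partialWeight i).1 * 2 ^ reqLength req i +
      (if (req i).isSome then 2 ^ (partialWeight i).2 else 0),
      (partialWeight i).2 + reqLength req i)

/-- The numerator, over the denominator `2ʳ⁺¹`, of the left end point of the dyadic interval for the
`i`-th request, if this is for a description of length `r`. -/
def leftEnd (i : ℕ) : ℕ :=
  (partialWeight req i).1 * 2 ^ (reqLength req i + 1) / 2 ^ (partialWeight req i).2 + 1

/-- The string that describes the object of the `i`-th request. The weights of the requests are
laid out in the unit interval one after the other; an interval of length `2⁻ʳ` contains a dyadic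
interval of length `2⁻ʳ⁻¹`. -/
def reqCode (i : ℕ) : List Bool :=
  bits (reqLength req i + 1) (leftEnd req i)

variable {req}

theorem primrec_reqLength (h : Primrec req) : Primrec (reqLength req) :=
  Primrec.option_getD.comp (Primrec.option_map h (Primrec.fst.comp Primrec.snd)) (Primrec.const 0)

theorem primrec_partialWeight (h : Primrec req) : Primrec (partialWeight req) := by
  have hr : Primrec fun x : ℕ × (ℕ × ℕ) => reqLength req x.1 :=
    (primrec_reqLength h).comp Primrec.fst
  have he : Primrec fun x : ℕ × (ℕ × ℕ) => x.2.2 := Primrec.snd.comp Primrec.snd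
  have h := Primrec.nat_rec₁ (f := fun i (x : ℕ × ℕ) => (x.1 * 2 ^ reqLength req i +
      (if (req i).isSome then 2 ^ x.2 else 0), x.2 + reqLength req i)) (0, 0) (by
    refine Primrec.pair (Primrec.nat_add.comp (Primrec.nat_mul.comp
      (Primrec.fst.comp Primrec.snd) (primrec_nat_pow.comp (Primrec.const 2) hr)) ?_)
      (Primrec.nat_add.comp he hr)
    exact Primrec.ite (Primrec.eq.comp (Primrec.option_isSome.comp (h.comp Primrec.fst))
      (Primrec.const true)) (primrec_nat_pow.comp (Primrec.const 2) he) (Primrec.const 0))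
  refine h.of_eq fun n => ?_
  induction n with
  | zero => rfl
  | succ n ih => simp only [partialWeight, ← ih]

theorem primrec_reqCode (h : Primrec req) : Primrec (reqCode req) := by
  have hr := primrec_reqLength h
  have hp := primrec_partialWeight h
  refine primrec_bits.comp (Primrec.succ.comp hr) (Primrec.succ.comp (Primrec.nat_div.comp
    (Primrec.nat_mul.comp (Primrec.fst.comp hp) (primrec_nat_pow.comp (Primrec.const 2)
      (Primrec.succ.comp hr))) (primrec_nat_pow.comp (Primrec.const 2) (Primrec.snd.comp hp))))

/-- The total weight of the requests before `i`, as a real number. -/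
noncomputable def partialSum (req : ℕ → Option (ℕ × List Bool)) (i : ℕ) : ℝ :=
  ∑ j ∈ Finset.range i, (weight (req j)).toReal

theorem partialWeight_eq (i : ℕ) : ((partialWeight req i).1 : ℝ) =
    partialSum req i * 2 ^ (partialWeight req i).2 := by
  induction i with
  | zero => simp [partialWeight, partialSum]
  | succ i ih =>
    rw [partialSum, Finset.sum_range_succ, ← partialSum]
    cases h : req i with
    | none => simp [partialWeight, reqLength, h, weight, ih]
    | some p =>
      simp only [partialWeight, reqLength, h, weight, Option.isSome_some, if_true, Option.map_some,
        Option.getD_some, Nat.cast_add, Nat.cast_mul, Nat.cast_pow, Nat.cast_ofNat, ih, pow_add,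
        ENNReal.toReal_pow, ENNReal.toReal_inv, ENNReal.toReal_ofNat, inv_pow]
      field_simp

theorem leftEnd_bounds {i : ℕ} {p : ℕ × List Bool} (h : req i = some p) :
    partialSum req i * 2 ^ (reqLength req i + 1) < leftEnd req i ∧
      (leftEnd req i + 1 : ℝ) ≤ partialSum req (i + 1) * 2 ^ (reqLength req i + 1) := by
  have hw : partialSum req (i + 1) * 2 ^ (reqLength req i + 1) =
      partialSum req i * 2 ^ (reqLength req i + 1) + 2 := by
    rw [partialSum, Finset.sum_range_succ, ← partialSum, add_mul]
    congr 1
    simp only [h, weight, reqLength, Option.map_some, Option.getD_some, ENNReal.toReal_pow,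
      ENNReal.toReal_inv, ENNReal.toReal_ofNat, pow_succ, inv_pow]
    field_simp
  have hx : partialSum req i * 2 ^ (reqLength req i + 1) =
      (((partialWeight req i).1 * 2 ^ (reqLength req i + 1) : ℕ) : ℝ) /
        ((2 ^ (partialWeight req i).2 : ℕ) : ℝ) := by
    push_cast
    rw [partialWeight_eq]
    field_simp
  have h1 := Nat.lt_floor_add_one ((((partialWeight req i).1 * 2 ^ (reqLength req i + 1) : ℕ) : ℝ) /
        ((2 ^ (partialWeight req i).2 : ℕ) : ℝ))
  have h2 := Nat.floor_le (a := (((partialWeight req i).1 * 2 ^ (reqLength req i + 1) : ℕ) : ℝ) /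
        ((2 ^ (partialWeight req i).2 : ℕ) : ℝ)) (by positivity)
  rw [Nat.floor_div_eq_div] at h1 h2
  rw [hw, hx, leftEnd]
  constructor
  · exact_mod_cast h1
  · push_cast at h2 ⊢
    linarith

theorem partialSum_mono : Monotone (partialSum req) := by
  intro i j hij
  exact Finset.sum_le_sum_of_subset_of_nonneg (Finset.range_subset_range.2 hij)
    fun _ _ _ => ENNReal.toReal_nonneg

theorem weight_ne_top {α : Type*} (o : Option (ℕ × α)) : weight o ≠ ⊤ := by
  cases o <;> simp [weight]

theorem partialSum_le_one (hw : ∑' i, weight (req i) ≤ 1) (i : ℕ) : partialSum req i ≤ 1 := by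
  rw [partialSum, ← ENNReal.toReal_sum fun _ _ => weight_ne_top _]
  exact ENNReal.toReal_le_of_le_ofReal zero_le_one
    (by simpa using (ENNReal.sum_le_tsum (Finset.range i)).trans hw)

theorem leftEnd_lt (hw : ∑' i, weight (req i) ≤ 1) {i : ℕ} {p : ℕ × List Bool}
    (h : req i = some p) : leftEnd req i < 2 ^ (reqLength req i + 1) := by
  have h1 := (leftEnd_bounds h).2
  have h2 := partialSum_le_one hw (i + 1)
  have h3 : partialSum req (i + 1) * 2 ^ (reqLength req i + 1) ≤ 2 ^ (reqLength req i + 1) :=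
    mul_le_of_le_one_left (by positivity) h2
  have : (leftEnd req i : ℝ) < 2 ^ (reqLength req i + 1) := by linarith
  exact_mod_cast this

theorem reqCode_prefixFree (hw : ∑' i, weight (req i) ≤ 1) {i j : ℕ} {p q : ℕ × List Bool}
    (hi : req i = some p) (hj : req j = some q) (h : reqCode req i <+: reqCode req j) : i = j := by
  obtain ⟨hRS, hdiv⟩ := eq_div_of_bits_prefix (leftEnd_lt hw hi) (leftEnd_lt hw hj) h
  obtain ⟨hi1, hi2⟩ := leftEnd_bounds hi
  obtain ⟨hj1, hj2⟩ := leftEnd_bounds hj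
  set R := reqLength req i + 1
  set S := reqLength req j + 1
  obtain ⟨k, hk⟩ := Nat.exists_eq_add_of_le hRS
  have hk' : S - R = k := by omega
  rw [hk'] at hdiv
  have h1 : leftEnd req i * 2 ^ k ≤ leftEnd req j := by
    rw [hdiv]; exact Nat.div_mul_le_self _ _
  have h2 : leftEnd req j < (leftEnd req i + 1) * 2 ^ k := by
    rw [hdiv]
    exact Nat.lt_mul_of_div_lt (Nat.lt_succ_self _) (by positivity)
  have h1' : (leftEnd req i : ℝ) * 2 ^ k ≤ leftEnd req j := by exact_mod_cast h1
  have h2' : (leftEnd req j : ℝ) < (leftEnd req i + 1) * 2 ^ k := by exact_mod_cast h2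
  have hpow : (0 : ℝ) < 2 ^ k := by positivity
  have hpowS : (0 : ℝ) < 2 ^ S := by positivity
  have hS : (2 : ℝ) ^ S = 2 ^ R * 2 ^ k := by rw [hk, pow_add]
  -- The left end for `j` lies in the dyadic interval for `i`, but the intervals in which the two
  -- requests are laid out are disjoint.
  by_contra hne
  rcases lt_or_gt_of_ne hne with hlt | hlt
  · have hm := partialSum_mono (req := req) (Nat.succ_le_of_lt hlt)
    have h3 : (leftEnd req j : ℝ) < partialSum req (i + 1) * 2 ^ S := by
      rw [hS, ← mul_assoc]
      exact h2'.trans_le (mul_le_mul_of_nonneg_right hi2 hpow.le)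
    have h4 := mul_le_mul_of_nonneg_right hm hpowS.le
    simp only [Nat.succ_eq_add_one] at h4
    linarith
  · have hm := partialSum_mono (req := req) (Nat.succ_le_of_lt hlt)
    have h3 : partialSum req i * 2 ^ S < leftEnd req j := by
      rw [hS, ← mul_assoc]
      exact (mul_lt_mul_of_pos_right hi1 hpow).trans_le h1'
    have h4 := mul_le_mul_of_nonneg_right hm hpowS.le
    simp only [Nat.succ_eq_add_one] at h4
    linarith

/-- A version of the machine existence (Kraft–Chaitin) theorem, with descriptions one bit longer
than asked for. -/
theorem exists_machine_of_requests (hreq : Primrec req) (hw : ∑' i, weight (req i) ≤ 1) :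
    ∃ M, IsPrefixFreeMachine M ∧ ∀ i r x, req i = some (r, x) →
      ∃ σ, x ∈ M σ ∧ σ.length = r + 1 := by
  let step : List Bool → ℕ → Option (List Bool) := fun σ i =>
    (req i).bind fun p => if σ = reqCode req i then some p.2 else none
  have hstep : Primrec₂ step := by
    refine Primrec.option_bind (hreq.comp Primrec.snd) ?_
    exact Primrec.ite (Primrec.eq.comp (Primrec.fst.comp Primrec.fst)
      ((primrec_reqCode hreq).comp (Primrec.snd.comp Primrec.fst)))
      (Primrec.option_some.comp (Primrec.snd.comp Primrec.snd)) (Primrec.const none)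
  have hmem : ∀ σ i x, x ∈ step σ i ↔ ∃ r, req i = some (r, x) ∧ σ = reqCode req i := by
    intro σ i x
    simp only [step, Option.mem_def, Option.bind_eq_some_iff]
    constructor
    · rintro ⟨⟨r, y⟩, h1, h2⟩
      split_ifs at h2 with h3
      exact ⟨r, by rw [h1]; simpa using h2, h3⟩
    · rintro ⟨r, h1, h2⟩
      exact ⟨(r, x), h1, by simp [h2]⟩
  refine ⟨fun σ => Nat.rfindOpt (step σ), ⟨Partrec.rfindOpt hstep.to_comp, ?_⟩, ?_⟩
  · intro σ τ hσ hτ h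
    obtain ⟨i, x, hx⟩ := Nat.rfindOpt_dom.1 hσ
    obtain ⟨j, y, hy⟩ := Nat.rfindOpt_dom.1 hτ
    obtain ⟨r, hi, rfl⟩ := (hmem _ _ _).1 hx
    obtain ⟨s, hj, rfl⟩ := (hmem _ _ _).1 hy
    rw [reqCode_prefixFree hw hi hj h]
  · intro i r x hi
    refine ⟨reqCode req i, ?_, by simp [reqCode, reqLength, hi]⟩
    have hdom : (Nat.rfindOpt (step (reqCode req i))).Dom :=
      Nat.rfindOpt_dom.2 ⟨i, x, (hmem _ _ _).2 ⟨r, hi, rfl⟩⟩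
    obtain ⟨y, hy⟩ := Part.dom_iff_mem.1 hdom
    obtain ⟨j, hj⟩ := Nat.rfindOpt_spec hy
    obtain ⟨s, hj, hc⟩ := (hmem _ _ _).1 hj
    have := reqCode_prefixFree hw hi hj (by rw [hc])
    subst this
    rw [hi] at hj
    obtain ⟨-, rfl⟩ := Prod.mk.inj (Option.some.inj hj)
    exact hy

end Requests

end Cantor

namespace Cantor

open Nat.Partrec (Code)
open Encodable Denumerable
open scoped ENNReal

/-! ### Enumerating the descriptions of the numbers -/

theorem primrec_replicate_false : Primrec fun n => List.replicate n false := by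
  refine (Primrec.list_map Primrec.list_range (g := fun _ _ => false) (Primrec.const false)).of_eq
    fun n => ?_
  simp

/-- The descriptions of numbers with respect to a prefix-free machine can be enumerated without
repetition, each as a pair of the length of the description and the number described, in such a
way that neither exceeds the stage of enumeration. -/
theorem exists_descriptions {U : List Bool →. List Bool} (hU : IsPrefixFreeMachine U) :
    ∃ d : ℕ → Option (ℕ × ℕ), Primrec d ∧ (∀ t p, d t = some p → p.1 ≤ t ∧ p.2 ≤ t) ∧
      ∑' t, weight (d t) ≤ 1 ∧
      ∀ σ x, List.replicate x false ∈ U σ → ∃ t, d t = some (σ.length, x) := by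
  classical
  obtain ⟨c, hc⟩ := Code.exists_code.1 hU.1
  have hcU : ∀ σ x, encode x ∈ Code.eval c (encode σ) ↔ x ∈ U σ := by
    intro σ x
    rw [hc]
    simp
  let str : ℕ → List Bool := fun t => (decode (α := List Bool) t.unpair.2.unpair.1).getD []
  let halts : ℕ → ℕ → Prop := fun t j =>
    Code.evaln j c (encode (str t)) = some (encode (List.replicate t.unpair.1 false))
  let first : ℕ → Prop := fun t =>
    encode (str t) = t.unpair.2.unpair.1 ∧
      halts t t.unpair.2.unpair.2 ∧ ∀ i < t.unpair.2.unpair.2, ¬ halts t i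
  have hu : Primrec fun t : ℕ => t.unpair.2.unpair :=
    Primrec.unpair.comp (Primrec.snd.comp Primrec.unpair)
  have hstr : Primrec str := Primrec.option_getD.comp
    (Primrec.decode.comp (Primrec.fst.comp hu)) (Primrec.const [])
  have hhalts : PrimrecRel halts := Primrec.eq.comp (Code.primrec_evaln.comp (Primrec.pair
      (Primrec.pair Primrec.snd (Primrec.const c)) (Primrec.encode.comp (hstr.comp Primrec.fst))))
    (Primrec.option_some.comp (Primrec.encode.comp (primrec_replicate_false.comp
      (Primrec.fst.comp (Primrec.unpair.comp Primrec.fst)))))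
  have hfirst : PrimrecPred first := (Primrec.eq.comp (Primrec.encode.comp hstr)
    (Primrec.fst.comp hu)).and <| (hhalts.comp Primrec.id (Primrec.snd.comp hu)).and
    (primrecPred_forall_lt (Primrec.snd.comp hu) hhalts.not)
  have hstrU : ∀ t, first t → List.replicate t.unpair.1 false ∈ U (str t) := fun t ht =>
    (hcU _ _).1 (Code.evaln_sound ht.2.1)
  refine ⟨fun t => if first t then some ((str t).length, t.unpair.1) else none,
    Primrec.ite hfirst (Primrec.option_some.comp (Primrec.pair (Primrec.list_length.comp hstr)
      (Primrec.fst.comp Primrec.unpair))) (Primrec.const none), ?_, ?_, ?_⟩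
  · intro t p hp
    dsimp only at hp
    split_ifs at hp with ht
    obtain rfl := Option.some.inj hp
    refine ⟨?_, Nat.unpair_left_le t⟩
    calc (str t).length ≤ encode (str t) := length_le_encode _
      _ = t.unpair.2.unpair.1 := ht.1
      _ ≤ t.unpair.2 := Nat.unpair_left_le _
      _ ≤ t := Nat.unpair_right_le _
  · refine tsum_weight_le_one (p := str) (fun t p hp => ?_) (fun t t' ht ht' h => ?_)
    · split_ifs at hp
      obtain rfl := Option.some.inj hp
      rfl
    · have h1 : first t := by by_contra h; simp [h] at ht
      have h2 : first t' := by by_contra h; simp [h] at ht'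
      have hs : str t = str t' := hU.2 _ _ (Part.dom_iff_mem.2 ⟨_, hstrU t h1⟩)
        (Part.dom_iff_mem.2 ⟨_, hstrU t' h2⟩) h
      have hx : t.unpair.1 = t'.unpair.1 := by
        have h3 := hstrU t' h2
        rw [← hs] at h3
        simpa using congrArg List.length (Part.mem_unique (hstrU t h1) h3)
      have hh : ∀ j, halts t j ↔ halts t' j := by
        intro j
        simp only [halts, hs, hx]
      have hj : t.unpair.2.unpair.2 = t'.unpair.2.unpair.2 := by
        rcases lt_trichotomy t.unpair.2.unpair.2 t'.unpair.2.unpair.2 with hlt | heq | hlt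
        · exact absurd ((hh _).1 h1.2.1) (h2.2.2 _ hlt)
        · exact heq
        · exact absurd ((hh _).2 h2.2.1) (h1.2.2 _ hlt)
      have hp : t.unpair.2.unpair.1 = t'.unpair.2.unpair.1 := by
        rw [← h1.1, ← h2.1, hs]
      rw [← Nat.pair_unpair t, ← Nat.pair_unpair t', hx, ← Nat.pair_unpair t.unpair.2,
        ← Nat.pair_unpair t'.unpair.2, hj, hp]
  · intro σ x hx
    have hex : ∃ j, Code.evaln j c (encode σ) = some (encode (List.replicate x false)) :=
      Code.evaln_complete.1 ((hcU _ _).2 hx)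
    refine ⟨Nat.pair x (Nat.pair (encode σ) (Nat.find hex)), ?_⟩
    have : first (Nat.pair x (Nat.pair (encode σ) (Nat.find hex))) := by
      simp only [first, halts, str, Nat.unpair_pair, encodek, Option.getD_some, true_and]
      exact ⟨Nat.find_spec hex, fun i hi => Nat.find_min hex hi⟩
    simp [this, str]

/-! ### The cost of enumerating a number -/

section Cost

variable (d : ℕ → Option (ℕ × ℕ))

/-- The `t`-th description if it describes a number above `n`. -/
def descrAbove (n t : ℕ) : Option (ℕ × ℕ) :=
  (d t).bind fun p => if n < p.2 then some p else none

/-- The weight of a description, scaled by `2ˢ`. This is exact for descriptions of length at most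
`s`, which is the only case needed. -/
def scaledWeight (s : ℕ) (o : Option (ℕ × ℕ)) : ℕ :=
  (o.map fun p => 2 ^ (s - p.1)).getD 0

/-- The cost of enumerating `n` at stage `s`, i.e. the weight of the descriptions of numbers above
`n` that have been enumerated before stage `s`, exceeds `2⁻ᵏ`. -/
def Expensive (k n s : ℕ) : Prop :=
  2 ^ s < 2 ^ k * ∑ t ∈ Finset.range s, scaledWeight s (descrAbove d n t)

variable {d}

theorem primrec_descrAbove (hd : Primrec d) : Primrec₂ (descrAbove d) :=
  Primrec.option_bind (hd.comp Primrec.snd) (Primrec.ite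
    (Primrec.nat_lt.comp (Primrec.fst.comp Primrec.fst) (Primrec.snd.comp Primrec.snd))
    (Primrec.option_some.comp Primrec.snd) (Primrec.const none))

theorem primrec_expensive {α : Type*} [Primcodable α] (hd : Primrec d) {k n s : α → ℕ}
    (hk : Primrec k) (hn : Primrec n) (hs : Primrec s) :
    PrimrecPred fun a => Expensive d (k a) (n a) (s a) := by
  have h2 : ∀ {f : α → ℕ}, Primrec f → Primrec fun a => 2 ^ f a := fun hf =>
    primrec_nat_pow.comp (Primrec.const 2) hf
  refine Primrec.nat_lt.comp (h2 hs) (Primrec.nat_mul.comp (h2 hk)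
    (primrec_sum_range hs (Primrec.option_getD.comp (Primrec.option_map
      ((primrec_descrAbove hd).comp (hn.comp Primrec.fst) Primrec.snd) ?_) (Primrec.const 0))))
  exact primrec_nat_pow.comp (Primrec.const 2) (Primrec.nat_sub.comp
    (hs.comp (Primrec.fst.comp Primrec.fst)) (Primrec.fst.comp Primrec.snd))

theorem descrAbove_eq_some {n t : ℕ} {p : ℕ × ℕ} :
    descrAbove d n t = some p ↔ d t = some p ∧ n < p.2 := by
  simp only [descrAbove, Option.bind_eq_some_iff]
  constructor
  · rintro ⟨q, h1, h2⟩
    split_ifs at h2 with h3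
    obtain rfl := Option.some.inj h2
    exact ⟨h1, h3⟩
  · rintro ⟨h1, h2⟩
    exact ⟨p, h1, by simp [h2]⟩

theorem weight_descrAbove_le (n t : ℕ) : weight (descrAbove d n t) ≤ weight (d t) := by
  cases h : descrAbove d n t with
  | none => simp [weight]
  | some p => rw [(descrAbove_eq_some.1 h).1]

theorem scaledWeight_eq {s : ℕ} {o : Option (ℕ × ℕ)} (h : ∀ p, o = some p → p.1 ≤ s) :
    (scaledWeight s o : ℝ≥0∞) = 2 ^ s * weight o := by
  cases o with
  | none => simp [scaledWeight, weight]
  | some p =>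
    obtain ⟨k, rfl⟩ := Nat.exists_eq_add_of_le (h p rfl)
    have h2 : (2 : ℝ≥0∞) ^ p.1 * 2⁻¹ ^ p.1 = 1 := by
      rw [← mul_pow, ENNReal.mul_inv_cancel (by simp) (by simp), one_pow]
    simp only [scaledWeight, weight, Option.map_some, Option.getD_some, Nat.add_sub_cancel_left]
    rw [pow_add, mul_right_comm, h2, one_mul]
    norm_cast

variable (hle : ∀ t p, d t = some p → p.1 ≤ t ∧ p.2 ≤ t)
include hle

theorem expensive_iff (k n s : ℕ) : Expensive d k n s ↔
    1 < 2 ^ k * ∑ t ∈ Finset.range s, weight (descrAbove d n t) := by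
  have h1 : ((∑ t ∈ Finset.range s, scaledWeight s (descrAbove d n t) : ℕ) : ℝ≥0∞) =
      2 ^ s * ∑ t ∈ Finset.range s, weight (descrAbove d n t) := by
    rw [Nat.cast_sum, Finset.mul_sum]
    refine Finset.sum_congr rfl fun t ht => scaledWeight_eq fun p hp => ?_
    exact (hle t p (descrAbove_eq_some.1 hp).1).1.trans (Finset.mem_range.1 ht).le
  have h2 : Expensive d k n s ↔ (2 : ℝ≥0∞) ^ s * 1 <
      2 ^ s * (2 ^ k * ∑ t ∈ Finset.range s, weight (descrAbove d n t)) := by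
    rw [mul_left_comm, ← h1, mul_one, Expensive]
    norm_cast
  rw [h2, ENNReal.mul_lt_mul_iff_right (by simp) (by simp)]

end Cost

/-! ### The witnesses -/

section Witness

variable (d : ℕ → Option (ℕ × ℕ))

open Classical in
/-- The witness of the `k`-th requirement is reset whenever it has become too expensive. This is
the pair of the stage of the last reset before stage `s` and the number of these resets. -/
noncomputable def resetState (k : ℕ) : ℕ → ℕ × ℕ
  | 0 => (0, 0)
  | s + 1 => if Expensive d k (Nat.pair k (resetState k s).1) s then
      (s, (resetState k s).2 + 1) else resetState k s

/-- The witness of the `k`-th requirement at stage `s`. -/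
noncomputable def witness (k s : ℕ) : ℕ := Nat.pair k (resetState d k s).1

/-- The number of resets of the witness of the `k`-th requirement before stage `s`. -/
noncomputable def resets (k s : ℕ) : ℕ := (resetState d k s).2

variable {d}

theorem primrec_resetState (hd : Primrec d) : Primrec₂ (resetState d) := by
  classical
  have h := Primrec.nat_rec (f := fun _ : ℕ => ((0, 0) : ℕ × ℕ)) (g := fun k (x : ℕ × (ℕ × ℕ)) =>
    if Expensive d k (Nat.pair k x.2.1) x.1 then (x.1, x.2.2 + 1) else x.2) (Primrec.const _) (by
      have hk : Primrec fun y : ℕ × ℕ × ℕ × ℕ => y.1 := Primrec.fst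
      have hs : Primrec fun y : ℕ × ℕ × ℕ × ℕ => y.2.1 := Primrec.fst.comp Primrec.snd
      have hx : Primrec fun y : ℕ × ℕ × ℕ × ℕ => y.2.2 := Primrec.snd.comp Primrec.snd
      exact Primrec.ite
        (primrec_expensive hd hk (Primrec₂.natPair.comp hk (Primrec.fst.comp hx)) hs)
        (Primrec.pair hs (Primrec.succ.comp (Primrec.snd.comp hx))) hx)
  refine h.of_eq fun k s => ?_
  induction s with
  | zero => rfl
  | succ s ih => simp only [resetState, ← ih]

theorem primrec_witness (hd : Primrec d) : Primrec₂ (witness d) :=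
  Primrec₂.natPair.comp Primrec.fst (Primrec.fst.comp (primrec_resetState hd))

theorem primrec_resets (hd : Primrec d) : Primrec₂ (resets d) :=
  Primrec.snd.comp (primrec_resetState hd)

theorem resetState_succ (k s : ℕ) :
    (Expensive d k (witness d k s) s ∧ resetState d k (s + 1) = (s, resets d k s + 1)) ∨
      (¬ Expensive d k (witness d k s) s ∧ resetState d k (s + 1) = resetState d k s) := by
  by_cases h : Expensive d k (witness d k s) s
  · exact Or.inl ⟨h, if_pos h⟩
  · exact Or.inr ⟨h, if_neg h⟩

theorem resets_mono (k : ℕ) : Monotone (resets d k) := by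
  refine monotone_nat_of_le_succ fun s => ?_
  rcases resetState_succ (d := d) k s with ⟨-, h⟩ | ⟨-, h⟩ <;> simp [resets, h]

/-- The witness is determined by the number of resets. -/
theorem witness_eq_of_resets_eq {k s t : ℕ} (h : resets d k s = resets d k t) :
    witness d k s = witness d k t := by
  wlog hst : s ≤ t generalizing s t
  · exact (this h.symm (le_of_not_ge hst)).symm
  induction t, hst using Nat.le_induction with
  | base => rfl
  | succ t hst ih =>
    have h1 := resets_mono (d := d) k hst
    rcases resetState_succ (d := d) k t with ⟨-, h2⟩ | ⟨-, h2⟩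
    · have h3 : resets d k (t + 1) = resets d k t + 1 := by rw [resets, h2]
      omega
    · have h3 : resets d k (t + 1) = resets d k t := by rw [resets, h2, resets]
      rw [ih (h.trans h3), witness, witness, h2]

section Bound

variable (hle : ∀ t p, d t = some p → p.1 ≤ t ∧ p.2 ≤ t)
include hle

/-- Different witnesses become expensive because of different descriptions. -/
theorem resets_le_mul_sum (k s : ℕ) : (resetState d k s).1 ≤ s ∧
    (resets d k s : ℝ≥0∞) ≤ 2 ^ k * ∑ t ∈ Finset.range (resetState d k s).1, weight (d t) := by
  induction s with
  | zero => simp [resets, resetState]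
  | succ s ih =>
    rcases resetState_succ (d := d) k s with ⟨h1, h2⟩ | ⟨-, h2⟩
    swap
    · rw [resets, h2]
      exact ⟨ih.1.trans (Nat.le_succ s), ih.2⟩
    rw [resets, h2]
    refine ⟨Nat.le_succ s, ?_⟩
    set a := (resetState d k s).1 with ha
    have h3 := (expensive_iff hle k _ s).1 h1
    have h4 : ∑ t ∈ Finset.range s, weight (descrAbove d (witness d k s) t) ≤
        ∑ t ∈ Finset.Ico a s, weight (d t) := by
      rw [Finset.range_eq_Ico, ← Finset.sum_Ico_consecutive _ (Nat.zero_le a) ih.1,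
        Finset.sum_eq_zero, zero_add]
      · exact Finset.sum_le_sum fun t _ => weight_descrAbove_le _ _
      · intro t ht
        -- Descriptions from before the last reset describe numbers below the witness.
        cases h : descrAbove d (witness d k s) t with
        | none => rfl
        | some p =>
          obtain ⟨h5, h6⟩ := descrAbove_eq_some.1 h
          have h7 := (hle t p h5).2
          have h8 : a ≤ witness d k s := Nat.right_le_pair _ _
          have h9 := (Finset.mem_Ico.1 ht).2
          omega
    have h5 : ∑ t ∈ Finset.range s, weight (d t) =
        ∑ t ∈ Finset.range a, weight (d t) + ∑ t ∈ Finset.Ico a s, weight (d t) := by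
      rw [Finset.range_eq_Ico, Finset.range_eq_Ico,
        Finset.sum_Ico_consecutive _ (Nat.zero_le a) ih.1]
    dsimp only
    rw [h5, mul_add]
    push_cast
    exact add_le_add ih.2 (h3.le.trans (by gcongr))

theorem resets_le (hw : ∑' t, weight (d t) ≤ 1) (k s : ℕ) : resets d k s ≤ 2 ^ k := by
  have h := (resets_le_mul_sum hle k s).2
  have h1 : (resets d k s : ℝ≥0∞) ≤ 2 ^ k * 1 :=
    h.trans (by gcongr; exact (ENNReal.sum_le_tsum _).trans hw)
  rw [mul_one] at h1
  exact_mod_cast h1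

/-- The witnesses settle. -/
theorem exists_settled (hw : ∑' t, weight (d t) ≤ 1) (k : ℕ) : ∃ s₀, ∀ s,
    resets d k s ≤ resets d k s₀ ∧
      (s₀ ≤ s → resets d k s = resets d k s₀ ∧ ¬ Expensive d k (witness d k s) s) := by
  have hbdd : BddAbove (Set.range (resets d k)) :=
    ⟨2 ^ k, by rintro _ ⟨s, rfl⟩; exact resets_le hle hw k s⟩
  obtain ⟨s₀, hs₀⟩ := Nat.sSup_mem (Set.range_nonempty _) hbdd
  have hmax : ∀ s, resets d k s ≤ resets d k s₀ := fun s => by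
    rw [hs₀]; exact le_csSup hbdd ⟨s, rfl⟩
  refine ⟨s₀, fun s => ⟨hmax s, fun hs => ?_⟩⟩
  have heq := le_antisymm (hmax s) (resets_mono k hs)
  refine ⟨heq, fun hE => ?_⟩
  rcases resetState_succ (d := d) k s with ⟨-, h2⟩ | ⟨h1, -⟩
  · have := hmax (s + 1)
    rw [resets, h2] at this
    simp only at this
    omega
  · exact h1 hE

end Bound

end Witness

end Cantor

namespace Cantor

open Nat.Partrec (Code)
open Encodable Denumerable
open scoped ENNReal

/-! ### Cost-controlled enumeration of witnesses -/

section Enumeration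

variable (d : ℕ → Option (ℕ × ℕ)) (T : ℕ → ℕ → ℕ → Prop)

/-- The `k`-th requirement wants to enumerate its witness at stage `s`: the condition `T` on the
requirement, the number of resets of its witness and the stage is fulfilled, at low cost. -/
def WantsToAct (k s : ℕ) : Prop :=
  ¬ Expensive d k (witness d k s) s ∧ T k (resets d k s) s

/-- The `k`-th requirement enumerates its witness at stage `s`; it does so at most once. -/
def Acts (k s : ℕ) : Prop :=
  WantsToAct d T k s ∧ ∀ r < s, ¬ WantsToAct d T k r

/-- The number `n` is enumerated at stage `s`. The number itself shows on behalf of which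
requirement this happens. -/
def Enters (n s : ℕ) : Prop :=
  Acts d T n.unpair.1 s ∧ witness d n.unpair.1 s = n

open Classical in
/-- The numbers enumerated before stage `s`. -/
noncomputable def enumBefore (s n : ℕ) : Bool := decide (∃ r < s, Enters d T n r)

open Classical in
/-- The set of the numbers that are ever enumerated. -/
noncomputable def enumSet (n : ℕ) : Bool := decide (∃ s, Enters d T n s)

open Classical in
/-- The requests for descriptions of initial segments of the enumerated set. The one at
`0, t, t` is made when the `t`-th description, of a number `x`, appears; it is for the current
initial segment of length `x`. The one at `k + 1, s, t` renews it when the action of the `k`-th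
requirement at stage `s` changes this initial segment. The length asked for exceeds that of the
given description by two, since the total weight before this shift is at most `1 + ∑ 2⁻ᵏ`. -/
noncomputable def segmentRequest (k s t : ℕ) : Option (ℕ × List Bool) :=
  (if k = 0 ∧ s = t then d t else
    if k ≠ 0 ∧ Acts d T (k - 1) s ∧ t < s then descrAbove d (witness d (k - 1) s) t else none).map
      fun p => (p.1 + 2, initSeg (enumBefore d T (s + 1)) p.2)

variable {d T}

theorem Acts.unique {k s t : ℕ} (hs : Acts d T k s) (ht : Acts d T k t) : s = t := by
  rcases lt_trichotomy s t with h | h | h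
  · exact absurd hs.1 (ht.2 _ h)
  · exact h
  · exact absurd ht.1 (hs.2 _ h)

theorem Enters.unique {n s t : ℕ} (hs : Enters d T n s) (ht : Enters d T n t) : s = t :=
  hs.1.unique ht.1

theorem Acts.enters {k s : ℕ} (h : Acts d T k s) : Enters d T (witness d k s) s := by
  rw [Enters, witness, Nat.unpair_pair]
  exact ⟨h, rfl⟩

theorem enumSet_eq_true {n : ℕ} : enumSet d T n = true ↔ ∃ s, Enters d T n s := by
  classical
  exact decide_eq_true_iff

theorem enumBefore_eq_true {s n : ℕ} : enumBefore d T s n = true ↔ ∃ r < s, Enters d T n r := by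
  classical
  exact decide_eq_true_iff

theorem exists_acts_iff {k : ℕ} : (∃ s, Acts d T k s) ↔ ∃ s, WantsToAct d T k s := by
  classical
  refine ⟨fun ⟨s, h⟩ => ⟨s, h.1⟩, fun h => ⟨Nat.find h, Nat.find_spec h, fun r hr => ?_⟩⟩
  exact Nat.find_min h hr

theorem enumSet_witness_eq_false {k s : ℕ} (h : ¬ ∃ s, Acts d T k s) :
    enumSet d T (witness d k s) = false := by
  rw [← Bool.not_eq_true, enumSet_eq_true]
  rintro ⟨r, hr, -⟩
  rw [witness, Nat.unpair_pair] at hr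
  exact h ⟨r, hr⟩

section Primrec

variable (hd : Primrec d) (hT : PrimrecPred fun x : ℕ × ℕ × ℕ => T x.1 x.2.1 x.2.2)
include hd hT

theorem primrec_wantsToAct : PrimrecRel (WantsToAct d T) :=
  (primrec_expensive hd Primrec.fst (primrec_witness hd) Primrec.snd).not.and
    (hT.comp (Primrec.pair Primrec.fst (Primrec.pair (primrec_resets hd) Primrec.snd)))

theorem primrec_acts : PrimrecRel (Acts d T) :=
  (primrec_wantsToAct hd hT).and (primrecPred_forall_lt Primrec.snd
    (PrimrecRel.comp (primrec_wantsToAct hd hT) (Primrec.fst.comp Primrec.fst) Primrec.snd).not)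

theorem primrec_enters : PrimrecRel (Enters d T) := by
  have h : Primrec fun x : ℕ × ℕ => x.1.unpair.1 :=
    Primrec.fst.comp (Primrec.unpair.comp Primrec.fst)
  exact ((primrec_acts hd hT).comp h Primrec.snd).and
    (Primrec.eq.comp ((primrec_witness hd).comp h Primrec.snd) Primrec.fst)

theorem primrec_enumBefore : Primrec₂ (enumBefore d T) := by
  classical
  exact (primrecPred_exists_lt (f := fun x : ℕ × ℕ => x.1) (R := fun x r => Enters d T x.2 r)
    Primrec.fst ((primrec_enters hd hT).comp (Primrec.snd.comp Primrec.fst) Primrec.snd)).decide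

theorem isCE_enumSet : IsCE (enumSet d T) :=
  (rePred_of_primrecRel (primrec_enters hd hT)).of_eq fun _ => enumSet_eq_true.symm

theorem primrec_segmentRequest :
    Primrec fun x : ℕ × ℕ × ℕ => segmentRequest d T x.1 x.2.1 x.2.2 := by
  have hk : Primrec fun x : ℕ × ℕ × ℕ => x.1 := Primrec.fst
  have hs : Primrec fun x : ℕ × ℕ × ℕ => x.2.1 := Primrec.fst.comp Primrec.snd
  have ht : Primrec fun x : ℕ × ℕ × ℕ => x.2.2 := Primrec.snd.comp Primrec.snd
  have hk' : Primrec fun x : ℕ × ℕ × ℕ => x.1 - 1 := Primrec.pred.comp hk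
  classical
  refine Primrec.option_map (Primrec.ite ((Primrec.eq.comp hk (Primrec.const 0)).and
    (Primrec.eq.comp hs ht)) (hd.comp ht) (Primrec.ite
      ((Primrec.eq.comp hk (Primrec.const 0)).not.and
        (((primrec_acts hd hT).comp hk' hs).and (Primrec.nat_lt.comp ht hs)))
      ((primrec_descrAbove hd).comp ((primrec_witness hd).comp hk' hs) ht)
      (Primrec.const none))) ?_
  refine Primrec.pair (Primrec.nat_add.comp (Primrec.fst.comp Primrec.snd) (Primrec.const 2)) ?_
  refine Primrec.list_map (Primrec.list_range.comp (Primrec.snd.comp Primrec.snd)) ?_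
  exact (primrec_enumBefore hd hT).comp
    (Primrec.succ.comp (hs.comp (Primrec.fst.comp Primrec.fst))) Primrec.snd

end Primrec

theorem weight_map_add_two {o : Option (ℕ × ℕ)} {f : ℕ × ℕ → List Bool} :
    weight (o.map fun p => (p.1 + 2, f p)) = 4⁻¹ * weight o := by
  cases o with
  | none => simp [weight]
  | some p =>
    have : (2 : ℝ≥0∞)⁻¹ ^ 2 = 4⁻¹ := by rw [← ENNReal.inv_pow]; norm_num
    simp only [weight, Option.map_some, pow_add, this]
    rw [mul_comm]

theorem tsum_segmentRequest_le (hle : ∀ t p, d t = some p → p.1 ≤ t ∧ p.2 ≤ t)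
    (hw : ∑' t, weight (d t) ≤ 1) :
    ∑' (k) (s) (t), weight (segmentRequest d T k s t) ≤ 1 := by
  have h0 : ∑' (s) (t), weight (segmentRequest d T 0 s t) ≤ 4⁻¹ := by
    have : ∀ s, ∑' t, weight (segmentRequest d T 0 s t) = 4⁻¹ * weight (d s) := by
      intro s
      rw [tsum_eq_single s fun t ht => by simp [segmentRequest, ht.symm, weight]]
      simp only [segmentRequest, and_self, if_true, weight_map_add_two]
    simp only [this]
    rw [ENNReal.tsum_mul_left]
    exact mul_le_of_le_one_right (by simp) hw
  have h1 : ∀ k, ∑' (s) (t), weight (segmentRequest d T (k + 1) s t) ≤ 4⁻¹ * 2⁻¹ ^ k := by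
    intro k
    by_cases hex : ∃ s, Acts d T k s
    swap
    · have : ∀ s, ¬ Acts d T k s := fun s hs => hex ⟨s, hs⟩
      simp [segmentRequest, this, weight]
    obtain ⟨s, hs⟩ := hex
    rw [tsum_eq_single s fun r hr => by
      have : ¬ Acts d T k r := fun h => hr (h.unique hs)
      simp [segmentRequest, this, weight]]
    rw [tsum_eq_sum (s := Finset.range s) fun t ht => by
      have : ¬ t < s := by simpa using ht
      simp [segmentRequest, this, weight]]
    have h2 : ∀ t ∈ Finset.range s, weight (segmentRequest d T (k + 1) s t) =
        4⁻¹ * weight (descrAbove d (witness d k s) t) := by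
      intro t ht
      have ht' := Finset.mem_range.1 ht
      simp only [segmentRequest, Nat.add_sub_cancel, Nat.succ_ne_zero, false_and, if_false, ne_eq,
        not_false_eq_true, hs, ht', and_self, if_true, weight_map_add_two]
    rw [Finset.sum_congr rfl h2, ← Finset.mul_sum]
    gcongr
    have h3 := (expensive_iff hle k _ s).not.1 hs.1.1
    rw [not_lt] at h3
    rwa [← ENNReal.inv_pow, ENNReal.le_inv_iff_mul_le, mul_comm]
  rw [tsum_eq_zero_add' ENNReal.summable]
  have hgeo : ∑' k : ℕ, (4⁻¹ * 2⁻¹ ^ k : ℝ≥0∞) = 2⁻¹ := by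
    rw [ENNReal.tsum_mul_left, ENNReal.tsum_geometric, ENNReal.one_sub_inv_two, inv_inv]
    rw [show (4 : ℝ≥0∞) = 2 * 2 by norm_num, ENNReal.mul_inv (by simp) (by simp), mul_assoc,
      ENNReal.inv_mul_cancel (by simp) (by simp), mul_one]
  calc _ ≤ (4⁻¹ : ℝ≥0∞) + ∑' k : ℕ, 4⁻¹ * 2⁻¹ ^ k := add_le_add h0 (ENNReal.tsum_le_tsum h1)
    _ = 4⁻¹ + 2⁻¹ := by rw [hgeo]
    _ ≤ 2⁻¹ + 2⁻¹ := by gcongr; norm_num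
    _ = 1 := ENNReal.inv_two_add_inv_two

/-- For each description, one of the requests is for the final initial segment. -/
theorem exists_segmentRequest_eq {t l x : ℕ} (h : d t = some (l, x)) :
    ∃ k s, segmentRequest d T k s t = some (l + 2, initSeg (enumSet d T) x) := by
  -- The last stage after `t`, if any, at which the initial segment of length `x` changes.
  have hlast : ∃ s, (s = t ∨ t < s ∧ ∃ n < x, Enters d T n s) ∧
      ∀ n < x, ∀ r, Enters d T n r → r ≤ s := by
    clear h
    induction x with
    | zero => exact ⟨t, Or.inl rfl, by simp⟩
    | succ x ih =>
      obtain ⟨s, hs, hmax⟩ := ih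
      have hts : t ≤ s := by
        rcases hs with rfl | ⟨h, -⟩
        exacts [le_rfl, h.le]
      by_cases hx : ∃ r, s < r ∧ Enters d T x r
      · obtain ⟨r, hr, hxr⟩ := hx
        refine ⟨r, Or.inr ⟨hts.trans_lt hr, x, Nat.lt_succ_self x, hxr⟩, fun n hn r' hr' => ?_⟩
        rcases Nat.lt_succ_iff_lt_or_eq.1 hn with hn | rfl
        · exact (hmax n hn r' hr').trans hr.le
        · exact (hr'.unique hxr).le
      · refine ⟨s, ?_, fun n hn r' hr' => ?_⟩
        · rcases hs with h | ⟨h, n, hn, hn'⟩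
          exacts [Or.inl h, Or.inr ⟨h, n, hn.trans (Nat.lt_succ_self x), hn'⟩]
        · rcases Nat.lt_succ_iff_lt_or_eq.1 hn with hn | rfl
          · exact hmax n hn r' hr'
          · exact not_lt.1 fun hlt => hx ⟨r', hlt, hr'⟩
  obtain ⟨s, hs, hmax⟩ := hlast
  have hseg : initSeg (enumBefore d T (s + 1)) x = initSeg (enumSet d T) x := by
    refine initSeg_congr fun n hn => Bool.eq_iff_iff.2 ?_
    rw [enumBefore_eq_true, enumSet_eq_true]
    exact ⟨fun ⟨r, _, hr⟩ => ⟨r, hr⟩, fun ⟨r, hr⟩ => ⟨r, Nat.lt_succ_of_le (hmax n hn r hr), hr⟩⟩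
  rcases hs with rfl | ⟨hts, n, hn, hacts, hwit⟩
  · exact ⟨0, s, by simp [segmentRequest, h, hseg]⟩
  · refine ⟨n.unpair.1 + 1, s, ?_⟩
    have h2 : descrAbove d (witness d n.unpair.1 s) t = some (l, x) := by
      rw [hwit]
      exact descrAbove_eq_some.2 ⟨h, hn⟩
    simp [segmentRequest, hacts, hts, h2, hseg]

end Enumeration

theorem prefixComplexity_le_add {U : List Bool →. List Bool} {x y : List Bool} {b : ℕ}
    (h : ∀ σ, x ∈ U σ → ∃ τ, y ∈ U τ ∧ τ.length ≤ σ.length + b) :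
    prefixComplexity U y ≤ prefixComplexity U x + b := by
  by_cases hx : ∃ σ, x ∈ U σ
  · have : ∃ σ, x ∈ U σ ∧ prefixComplexity U x = σ.length := by
      classical
      have hex : ∃ n, ∃ σ, x ∈ U σ ∧ σ.length = n := by
        obtain ⟨σ, hσ⟩ := hx
        exact ⟨_, σ, hσ, rfl⟩
      obtain ⟨σ, hσ, hn⟩ := Nat.find_spec hex
      refine ⟨σ, hσ, le_antisymm (iInf₂_le σ hσ) (le_iInf₂ fun τ hτ => ?_)⟩
      rw [hn]
      exact_mod_cast Nat.find_min' hex ⟨τ, hτ, rfl⟩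
    obtain ⟨σ, hσ, hK⟩ := this
    obtain ⟨τ, hτ, hle⟩ := h σ hσ
    rw [hK]
    exact (iInf₂_le τ hτ).trans (by exact_mod_cast hle)
  · have : prefixComplexity U x = ⊤ := by
      simp only [prefixComplexity, iInf_eq_top]
      exact fun σ hσ => absurd ⟨σ, hσ⟩ hx
    simp [this]

/-- A cost-controlled enumeration, for the costs given by an optimal machine, results in a
`K`-trivial set. -/
theorem isKTrivial_enumSet {U₀ : List Bool →. List Bool} (hU₀ : IsOptimalMachine U₀)
    {d : ℕ → Option (ℕ × ℕ)} (hd : Primrec d) (hle : ∀ t p, d t = some p → p.1 ≤ t ∧ p.2 ≤ t)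
    (hw : ∑' t, weight (d t) ≤ 1)
    (hdescr : ∀ σ x, List.replicate x false ∈ U₀ σ → ∃ t, d t = some (σ.length, x))
    {T : ℕ → ℕ → ℕ → Prop} (hT : PrimrecPred fun x : ℕ × ℕ × ℕ => T x.1 x.2.1 x.2.2) :
    IsKTrivial (enumSet d T) := by
  intro U hU
  let req : ℕ → Option (ℕ × List Bool) := fun i =>
    segmentRequest d T i.unpair.1 i.unpair.2.unpair.1 i.unpair.2.unpair.2
  have hreq : Primrec req := by
    have hu : Primrec fun i : ℕ => i.unpair.2.unpair :=
      Primrec.unpair.comp (Primrec.snd.comp Primrec.unpair)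
    exact (primrec_segmentRequest hd hT).comp (Primrec.pair (Primrec.fst.comp Primrec.unpair) hu)
  have hsum : ∑' i, weight (req i) ≤ 1 := by
    refine le_trans (le_of_eq ?_) (tsum_segmentRequest_le (T := T) hle hw)
    have hpair : ∀ f : ℕ → ℝ≥0∞, ∑' i, f i = ∑' (a) (b), f (Nat.pair a b) := fun f => by
      rw [← Nat.pairEquiv.tsum_eq f]
      exact ENNReal.tsum_prod (f := fun a b => f (Nat.pair a b))
    rw [hpair]
    refine tsum_congr fun k => ?_
    rw [hpair]
    simp [req]
  obtain ⟨M, hM, hMreq⟩ := exists_machine_of_requests hreq hsum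
  obtain ⟨c₀, hc₀⟩ := hU₀.2 U hU.1
  obtain ⟨c, hc⟩ := hU.2 M hM
  refine ⟨c₀ + 3 + c, fun n => prefixComplexity_le_add fun σ hσ => ?_⟩
  obtain ⟨p, hp, hpl⟩ := hc₀ _ _ hσ
  obtain ⟨t, ht⟩ := hdescr p n hp
  obtain ⟨k, s, hks⟩ := exists_segmentRequest_eq (T := T) ht
  obtain ⟨ρ, hρ, hρl⟩ := hMreq (Nat.pair k (Nat.pair s t)) _ _ (by simpa [req] using hks)
  obtain ⟨τ, hτ, hτl⟩ := hc _ _ hρ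
  exact ⟨τ, hτ, by omega⟩

end Cantor

namespace Cantor

open Nat.Partrec (Code)
open Encodable Denumerable Filter
open scoped ENNReal

/-! ### Splitting `Π⁰₁` classes of random sets -/

theorem exists_splitIndex : ∃ idx : ℕ × ℕ × Bool → ℕ, Primrec idx ∧ ∀ x σ,
    σ ∈ ceStrings (idx x) ↔ σ ∈ ceStrings x.1 ∨ σ[x.2.1]? = some (!x.2.2) := by
  refine exists_index (p := fun y : (ℕ × ℕ × Bool) × List Bool =>
    y.2 ∈ ceStrings y.1.1 ∨ y.2[y.1.2.1]? = some (!y.1.2.2)) ?_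
  refine (rePred_of_primrecRel (R := fun (y : (ℕ × ℕ × Bool) × List Bool) s =>
    EnumBy y.1.1 y.2 s ∨ y.2[y.1.2.1]? = some (!y.1.2.2)) ?_).of_eq fun y => ?_
  · have hy : Primrec fun z : ((ℕ × ℕ × Bool) × List Bool) × ℕ => z.1.1 :=
      Primrec.fst.comp Primrec.fst
    have hσ : Primrec fun z : ((ℕ × ℕ × Bool) × List Bool) × ℕ => z.1.2 :=
      Primrec.snd.comp Primrec.fst
    exact (primrec_enumBy (Primrec.fst.comp hy) hσ Primrec.snd).or
      (Primrec.eq.comp (Primrec.list_getElem?.comp hσ (Primrec.fst.comp (Primrec.snd.comp hy)))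
        (Primrec.option_some.comp (Primrec.not.comp (Primrec.snd.comp (Primrec.snd.comp hy)))))
  · rw [exists_or, exists_const]
    rfl

/-- An index of the class of those members `Z` of the `q`-th `Π⁰₁` class with `Z(j) = b`. -/
noncomputable def splitIndex (q j : ℕ) (b : Bool) : ℕ :=
  exists_splitIndex.choose (q, j, b)

theorem primrec_splitIndex {α : Type*} [Primcodable α] {q j : α → ℕ} {b : α → Bool}
    (hq : Primrec q) (hj : Primrec j) (hb : Primrec b) :
    Primrec fun a => splitIndex (q a) (j a) (b a) :=
  exists_splitIndex.choose_spec.1.comp (Primrec.pair hq (Primrec.pair hj hb))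

theorem mem_piClass_splitIndex {q j : ℕ} {b : Bool} {Z : ℕ → Bool} :
    Z ∈ piClass (splitIndex q j b) ↔ Z ∈ piClass q ∧ Z j = b := by
  have h := fun n => exists_splitIndex.choose_spec.2 (q, j, b) (initSeg Z n)
  simp only [mem_piClass, splitIndex, h, not_or, forall_and]
  refine and_congr_right fun _ => ⟨fun h => ?_, fun h n hn => ?_⟩
  · by_contra hne
    refine h (j + 1) ?_
    rw [getElem?_initSeg Z (Nat.lt_succ_self j)]
    cases b <;> cases hZ : Z j <;> simp_all
  · have hjn : j < n := by
      by_contra hjn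
      simp [initSeg, hjn] at hn
    rw [getElem?_initSeg Z hjn, h] at hn
    cases b <;> simp at hn

/-- A Martin-Löf test whose `m`-th component captures all members of the `q`-th `Π⁰₁` class if they
have the same initial segment of length `m + q + 1`. Such a segment is found by waiting until all
branchings off it are seen to be empty; that the segment itself still looks extendible at this
stage ensures that only one string of each length is found. -/
def splitTest (m : ℕ) : Set (List Bool) :=
  {σ | m < σ.length ∧ ∃ s, ∀ j < σ.length,
    SeenEmpty (splitIndex (σ.length - m - 1) j (!σ.getD j false)) s ∧
      ¬ SeenEmpty (splitIndex (σ.length - m - 1) j (σ.getD j false)) s}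

theorem rePred_splitTest : REPred fun x : ℕ × List Bool => x.2 ∈ splitTest x.1 := by
  refine (rePred_of_primrecRel (R := fun (x : ℕ × List Bool) s =>
    x.1 < x.2.length ∧ ∀ j < x.2.length,
      SeenEmpty (splitIndex (x.2.length - x.1 - 1) j (!x.2.getD j false)) s ∧
        ¬ SeenEmpty (splitIndex (x.2.length - x.1 - 1) j (x.2.getD j false)) s) ?_).of_eq
    fun x => by simp [splitTest]
  have hl : Primrec fun y : (ℕ × List Bool) × ℕ => y.1.2.length :=
    Primrec.list_length.comp (Primrec.snd.comp Primrec.fst)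
  have hm : Primrec fun y : (ℕ × List Bool) × ℕ => y.1.1 := Primrec.fst.comp Primrec.fst
  have hq : Primrec fun z : ((ℕ × List Bool) × ℕ) × ℕ => z.1.1.2.length - z.1.1.1 - 1 :=
    Primrec.nat_sub.comp (Primrec.nat_sub.comp (hl.comp Primrec.fst) (hm.comp Primrec.fst))
      (Primrec.const 1)
  have hb : Primrec fun z : ((ℕ × List Bool) × ℕ) × ℕ => z.1.1.2.getD z.2 false :=
    (Primrec.list_getD false).comp (Primrec.snd.comp (Primrec.fst.comp Primrec.fst)) Primrec.snd
  have hs : Primrec fun z : ((ℕ × List Bool) × ℕ) × ℕ => z.1.2 := Primrec.snd.comp Primrec.fst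
  exact (Primrec.nat_lt.comp hm hl).and (primrecPred_forall_lt hl
    ((primrec_seenEmpty (primrec_splitIndex hq Primrec.snd (Primrec.not.comp hb)) hs).and
      (primrec_seenEmpty (primrec_splitIndex hq Primrec.snd hb) hs).not))

theorem splitTest_unique {m : ℕ} {σ τ : List Bool} (hσ : σ ∈ splitTest m) (hτ : τ ∈ splitTest m)
    (h : σ.length = τ.length) : σ = τ := by
  obtain ⟨-, s, hs⟩ := hσ
  obtain ⟨-, t, ht⟩ := hτ
  wlog hst : s ≤ t generalizing σ τ s t
  · exact (this h.symm t ht s hs (le_of_not_ge hst)).symm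
  refine List.ext_getElem h fun j h1 h2 => ?_
  by_contra hne
  refine (ht j h2).2 (SeenEmpty.mono ?_ hst)
  have h3 := (hs j h1).1
  have h4 : σ.getD j false = σ[j] := by simp [h1]
  have h5 : τ.getD j false = τ[j] := by simp [h2]
  rw [← h, h5]
  rw [h4] at h3
  have : τ[j] = !σ[j] := by
    cases hx : σ[j] <;> cases hy : τ[j] <;> simp_all
  rwa [this]

theorem isMLTest_splitTest : IsMLTest splitTest := by
  refine ⟨rePred_splitTest, fun m => ?_⟩
  have hsub : openOf (splitTest m) ⊆ ⋃ q : ℕ, {Z | initSeg Z (m + q + 1) ∈ splitTest m} := by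
    rintro Z ⟨n, hn⟩
    have hmn : m < n := by simpa using hn.1
    refine Set.mem_iUnion.2 ⟨n - m - 1, ?_⟩
    rw [Set.mem_ofPred_eq, show m + (n - m - 1) + 1 = n by omega]
    exact hn
  have hq : ∀ q : ℕ, fairCoin {Z | initSeg Z (m + q + 1) ∈ splitTest m} ≤
      2⁻¹ ^ (m + 1) * 2⁻¹ ^ q := by
    intro q
    by_cases hex : ∃ σ ∈ splitTest m, σ.length = m + q + 1
    · obtain ⟨σ, hσ, hl⟩ := hex
      have hle : {Z | initSeg Z (m + q + 1) ∈ splitTest m} ⊆ cylinder σ := by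
        intro Z hZ
        rw [cylinder, Set.mem_ofPred_eq, hl]
        exact splitTest_unique hZ hσ (by simp [hl])
      refine (MeasureTheory.measure_mono hle).trans ?_
      rw [fairCoin_cylinder, hl, ← pow_add, show m + 1 + q = m + q + 1 by omega]
    · have : {Z | initSeg Z (m + q + 1) ∈ splitTest m} = ∅ :=
        Set.eq_empty_of_forall_notMem fun Z hZ => hex ⟨_, hZ, length_initSeg _ _⟩
      simp [this]
  calc fairCoin (openOf (splitTest m))
      ≤ ∑' q : ℕ, fairCoin {Z | initSeg Z (m + q + 1) ∈ splitTest m} :=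
        (MeasureTheory.measure_mono hsub).trans (MeasureTheory.measure_iUnion_le _)
    _ ≤ ∑' q : ℕ, 2⁻¹ ^ (m + 1) * 2⁻¹ ^ q := ENNReal.tsum_le_tsum hq
    _ = 2⁻¹ ^ m := by
      rw [ENNReal.tsum_mul_left, ENNReal.tsum_geometric, ENNReal.one_sub_inv_two, inv_inv,
        pow_succ, mul_assoc, ENNReal.inv_mul_cancel (by simp) (by simp), mul_one]

/-- Outside the `m`-th component of the test, every nonempty `Π⁰₁` class branches early. -/
theorem exists_split {m q : ℕ} (hne : (piClass q).Nonempty)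
    (hdisj : Disjoint (piClass q) (openOf (splitTest m))) :
    ∃ j < m + q + 1, ∀ b, (piClass (splitIndex q j b)).Nonempty := by
  obtain ⟨Z, hZ⟩ := hne
  by_contra! hcon
  have hempty : ∀ j < m + q + 1, piClass (splitIndex q j (!Z j)) = ∅ := by
    intro j hj
    obtain ⟨b, hb⟩ := hcon j hj
    have hbZ : Z j ≠ b := fun h => by
      have : Z ∈ piClass (splitIndex q j b) := mem_piClass_splitIndex.2 ⟨hZ, h⟩
      simp [hb] at this
    rwa [show (!Z j) = b by cases hx : Z j <;> cases b <;> simp_all]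
  have hstage : ∀ᶠ s in atTop, ∀ j ∈ Finset.range (m + q + 1),
      SeenEmpty (splitIndex q j (!Z j)) s := by
    refine (eventually_all_finset _).2 fun j hj => ?_
    obtain ⟨s, hs⟩ := exists_seenEmpty (hempty j (Finset.mem_range.1 hj))
    exact eventually_atTop.2 ⟨s, fun t ht => hs.mono ht⟩
  obtain ⟨s, hs⟩ := hstage.exists
  refine Set.disjoint_left.1 hdisj hZ ⟨m + q + 1, ?_, s, fun j hj => ?_⟩
  · rw [length_initSeg]
    omega
  · rw [length_initSeg] at hj ⊢
    rw [show m + q + 1 - m - 1 = q by omega, getD_initSeg Z hj]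
    refine ⟨hs j (Finset.mem_range.2 hj), fun h => ?_⟩
    have : Z ∈ piClass (splitIndex q j (Z j)) := mem_piClass_splitIndex.2 ⟨hZ, rfl⟩
    simp [h.piClass_eq_empty] at this

/-- Whether both values at `j` are taken by members of the `q`-th `Π⁰₁` class. -/
def SplitsAt (q j : ℕ) : Prop :=
  (piClass (splitIndex q j false)).Nonempty ∧ (piClass (splitIndex q j true)).Nonempty

open Classical in
/-- The first position below `m + q + 1` at which the `q`-th `Π⁰₁` class splits. -/
noncomputable def splitPos (m q : ℕ) : ℕ :=
  ((List.range (m + q + 1)).map fun j => decide (SplitsAt q j)).findIdx id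

theorem splitsAt_splitPos {m q : ℕ} (hne : (piClass q).Nonempty)
    (hdisj : Disjoint (piClass q) (openOf (splitTest m))) (b : Bool) :
    (piClass (splitIndex q (splitPos m q) b)).Nonempty := by
  classical
  obtain ⟨j, hj, h⟩ := exists_split hne hdisj
  have hlt : splitPos m q <
      ((List.range (m + q + 1)).map fun j => decide (SplitsAt q j)).length :=
    List.findIdx_lt_length_of_exists ⟨true,
      List.mem_map.2 ⟨j, List.mem_range.2 hj, decide_eq_true ⟨h _, h _⟩⟩, rfl⟩
  have hs : SplitsAt q (splitPos m q) := by
    have h1 := List.findIdx_getElem (w := hlt)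
    have h2 : ∀ (i : ℕ) (hi : i < ((List.range (m + q + 1)).map fun j =>
        decide (SplitsAt q j)).length),
        id ((List.range (m + q + 1)).map fun j => decide (SplitsAt q j))[i] = true →
          SplitsAt q i := by simp
    exact h2 _ hlt h1
  cases b
  exacts [hs.1, hs.2]

/-! ### The requirements -/

section Requirements

variable {d : ℕ → Option (ℕ × ℕ)}

theorem exists_avoidIndex (hd : Primrec d) : ∃ idx : ℕ × ℕ → ℕ, Primrec idx ∧ ∀ x σ,
    σ ∈ ceStrings (idx x) ↔ σ ∈ ceStrings x.1.unpair.2 ∨ resets d x.1 σ.length = x.2 ∧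
      ∃ t, ReturnsZero x.1.unpair.1 (witness d x.1 σ.length) σ t := by
  refine exists_index (p := fun y : (ℕ × ℕ) × List Bool => y.2 ∈ ceStrings y.1.1.unpair.2 ∨
    resets d y.1.1 y.2.length = y.1.2 ∧
      ∃ t, ReturnsZero y.1.1.unpair.1 (witness d y.1.1 y.2.length) y.2 t) ?_
  refine (rePred_of_primrecRel (R := fun (y : (ℕ × ℕ) × List Bool) t =>
    EnumBy y.1.1.unpair.2 y.2 t ∨ resets d y.1.1 y.2.length = y.1.2 ∧
      ReturnsZero y.1.1.unpair.1 (witness d y.1.1 y.2.length) y.2 t) ?_).of_eq fun y => ?_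
  · have hk : Primrec fun z : ((ℕ × ℕ) × List Bool) × ℕ => z.1.1.1 :=
      Primrec.fst.comp (Primrec.fst.comp Primrec.fst)
    have hu : Primrec fun z : ((ℕ × ℕ) × List Bool) × ℕ => z.1.1.1.unpair := Primrec.unpair.comp hk
    have hσ : Primrec fun z : ((ℕ × ℕ) × List Bool) × ℕ => z.1.2 := Primrec.snd.comp Primrec.fst
    have hl := Primrec.list_length.comp hσ
    exact (primrec_enumBy (Primrec.snd.comp hu) hσ Primrec.snd).or
      ((Primrec.eq.comp ((primrec_resets hd).comp hk hl)
        (Primrec.snd.comp (Primrec.fst.comp Primrec.fst))).and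
        (primrec_returnsZero (Primrec.fst.comp hu) ((primrec_witness hd).comp hk hl) hσ
          Primrec.snd))
  · rw [exists_or, exists_and_left]
    rfl

/-- For `k` coding the pair of `e` and `q`, an index of the class of those members `Z` of the
`q`-th `Π⁰₁` class such that `Φ_e` with oracle `Z` does not return `0` on the witness of the `k`-th
requirement after `N` resets. -/
noncomputable def avoidIndex (hd : Primrec d) : ℕ × ℕ → ℕ :=
  (exists_avoidIndex hd).choose

theorem primrec_avoidIndex (hd : Primrec d) : Primrec (avoidIndex hd) :=
  (exists_avoidIndex hd).choose_spec.1

theorem piClass_avoidIndex_subset (hd : Primrec d) (k N : ℕ) :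
    piClass (avoidIndex hd (k, N)) ⊆ piClass k.unpair.2 := by
  intro Z hZ
  rw [mem_piClass] at hZ ⊢
  exact fun n hn => hZ n (((exists_avoidIndex hd).choose_spec.2 (k, N) _).2 (Or.inl hn))

theorem zero_mem_phi_of_avoidIndex_eq_empty (hd : Primrec d) {k s : ℕ}
    (h : piClass (avoidIndex hd (k, resets d k s)) = ∅) {Z : ℕ → Bool}
    (hZ : Z ∈ piClass k.unpair.2) : 0 ∈ Phi k.unpair.1 Z (witness d k s) := by
  have : Z ∉ piClass (avoidIndex hd (k, resets d k s)) := by simp [h]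
  simp only [mem_piClass, not_forall, not_not] at this
  obtain ⟨n, hn⟩ := this
  rcases ((exists_avoidIndex hd).choose_spec.2 _ _).1 hn with h1 | ⟨h1, t, h2⟩
  · exact absurd h1 (mem_piClass.1 hZ n)
  · rw [witness_eq_of_resets_eq h1] at h2
    exact h2.mem_phi

theorem zero_notMem_phi_of_mem_avoidIndex (hd : Primrec d) {k s : ℕ}
    (hs : ∀ r ≥ s, resets d k r = resets d k s) {Z : ℕ → Bool}
    (hZ : Z ∈ piClass (avoidIndex hd (k, resets d k s))) :
    0 ∉ Phi k.unpair.1 Z (witness d k s) := by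
  intro h0
  obtain ⟨r, ⟨t, ht⟩, hr⟩ := ((eventually_returnsZero h0).and (eventually_ge_atTop s)).exists
  refine mem_piClass.1 hZ r (((exists_avoidIndex hd).choose_spec.2 _ _).2 (Or.inr ?_))
  simp only [length_initSeg]
  refine ⟨hs r hr, t, ?_⟩
  rwa [witness_eq_of_resets_eq (hs r hr)]

/-- At stage `s` it is seen that the class is empty that has to be avoided by the `k`-th
requirement, whose witness has been reset `N` times. -/
def AvoidSeenEmpty (hd : Primrec d) (k N s : ℕ) : Prop :=
  SeenEmpty (avoidIndex hd (k, N)) s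

theorem primrec_avoidSeenEmpty (hd : Primrec d) :
    PrimrecPred fun x : ℕ × ℕ × ℕ => AvoidSeenEmpty hd x.1 x.2.1 x.2.2 :=
  primrec_seenEmpty ((primrec_avoidIndex hd).comp
    (Primrec.pair Primrec.fst (Primrec.fst.comp Primrec.snd))) (Primrec.snd.comp Primrec.snd)

open Classical in
/-- The total number of resets of the witness of the `k`-th requirement, as the least number that is
not exceeded; the search is bounded since there are at most `2ᵏ` resets. -/
noncomputable def finalResets (d : ℕ → Option (ℕ × ℕ)) (k : ℕ) : ℕ :=
  ((List.range (2 ^ k + 1)).map fun i => decide (∃ s, i < resets d k s)).findIdx (! ·)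

theorem finalResets_eq {k s₀ : ℕ} (hmax : ∀ s, resets d k s ≤ resets d k s₀)
    (hle : resets d k s₀ ≤ 2 ^ k) : finalResets d k = resets d k s₀ := by
  classical
  have hiff : ∀ i, (∃ s, i < resets d k s) ↔ i < resets d k s₀ :=
    fun i => ⟨fun ⟨s, hs⟩ => hs.trans_le (hmax s), fun h => ⟨s₀, h⟩⟩
  rw [finalResets, List.findIdx_eq (by simpa using Nat.lt_succ_of_le hle)]
  simp only [hiff, List.getElem_map, List.getElem_range]
  simp

/-- The members of the class of a requirement that acts do not compute the enumerated set. -/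
theorem phi_ne_char_of_acts (hd : Primrec d) {k : ℕ} (h : ∃ s, Acts d (AvoidSeenEmpty hd) k s)
    {Z : ℕ → Bool} (hZ : Z ∈ piClass k.unpair.2) :
    Phi k.unpair.1 Z ≠ char (enumSet d (AvoidSeenEmpty hd)) := by
  obtain ⟨s, hs⟩ := h
  intro heq
  have h0 := zero_mem_phi_of_avoidIndex_eq_empty hd
    (SeenEmpty.piClass_eq_empty (show SeenEmpty _ s from hs.1.2)) hZ
  rw [heq, char, enumSet_eq_true.2 ⟨s, hs.enters⟩] at h0
  simp at h0

/-- If a requirement does not act, its final witness stays cheap, so that the class of those sets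
for which the computation on the final witness does not return `0` cannot be empty. -/
theorem not_acts (hd : Primrec d) (hle : ∀ t p, d t = some p → p.1 ≤ t ∧ p.2 ≤ t)
    (hw : ∑' t, weight (d t) ≤ 1) {k : ℕ} (h : ¬ ∃ s, Acts d (AvoidSeenEmpty hd) k s) :
    (piClass (avoidIndex hd (k, finalResets d k))).Nonempty ∧
      ∀ Z ∈ piClass (avoidIndex hd (k, finalResets d k)),
        Phi k.unpair.1 Z ≠ char (enumSet d (AvoidSeenEmpty hd)) := by
  obtain ⟨s₀, hs₀⟩ := exists_settled hle hw k
  rw [finalResets_eq (fun s => (hs₀ s).1) (resets_le hle hw k s₀)]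
  constructor
  · by_contra hempty
    -- Emptiness would be seen at a stage at which the witness has settled and is cheap.
    obtain ⟨s, hs⟩ := exists_seenEmpty (Set.not_nonempty_iff_eq_empty.1 hempty)
    obtain ⟨h1, h2⟩ := (hs₀ (max s s₀)).2 (le_max_right _ _)
    refine h (exists_acts_iff.2 ⟨max s s₀, h2, ?_⟩)
    rw [AvoidSeenEmpty, h1]
    exact hs.mono (le_max_left _ _)
  · intro Z hZ heq
    refine zero_notMem_phi_of_mem_avoidIndex hd (fun r hr => ((hs₀ r).2 hr).1) hZ ?_
    rw [heq, char, enumSet_witness_eq_false h]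
    exact Part.mem_some _

open Classical in
/-- An index of a subclass of the `q`-th `Π⁰₁` class on which `Φ_e` fails to compute the enumerated
set. -/
noncomputable def satisfyIndex (hd : Primrec d) (e q : ℕ) : ℕ :=
  if ∃ s, Acts d (AvoidSeenEmpty hd) (Nat.pair e q) s then q else
    avoidIndex hd (Nat.pair e q, finalResets d (Nat.pair e q))

theorem satisfyIndex_spec (hd : Primrec d) (hle : ∀ t p, d t = some p → p.1 ≤ t ∧ p.2 ≤ t)
    (hw : ∑' t, weight (d t) ≤ 1) (e : ℕ) {q : ℕ} (hq : (piClass q).Nonempty) :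
    (piClass (satisfyIndex hd e q)).Nonempty ∧ piClass (satisfyIndex hd e q) ⊆ piClass q ∧
      ∀ Z ∈ piClass (satisfyIndex hd e q),
        Phi e Z ≠ char (enumSet d (AvoidSeenEmpty hd)) := by
  rw [satisfyIndex]
  split_ifs with h
  · refine ⟨hq, subset_rfl, fun Z hZ => ?_⟩
    have := phi_ne_char_of_acts hd h (Z := Z) (by simpa using hZ)
    simpa using this
  · obtain ⟨h1, h2⟩ := not_acts hd hle hw h
    refine ⟨h1, ?_, fun Z hZ => ?_⟩
    · simpa using piClass_avoidIndex_subset hd (Nat.pair e q) (finalResets d (Nat.pair e q))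
    · simpa using h2 Z hZ

end Requirements

/-! ### Truth-table computability in the jump -/

section Jump

variable (Z : ℕ → Bool)

open Classical in
theorem ttComputable_decide_rePred {α : Type*} [Primcodable α] {p : α → Prop} (hp : REPred p) :
    TTComputable (jump Z) fun a => decide (p a) := by
  obtain ⟨r, hr, h⟩ := exists_jump_query_re hp
  have := TTComputable.query (A := jump Z) hr
  have heq : (fun a => jump Z (r a)) = fun a => decide (p a) :=
    funext fun a => Bool.eq_iff_iff.2 ((h Z a).trans decide_eq_true_iff.symm)
  rwa [heq] at this

theorem ttComputable_self : TTComputable (jump Z) Z := by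
  obtain ⟨r, hr, h⟩ := exists_jump_query_mem
  have := TTComputable.query (A := jump Z) hr
  have heq : (fun n => jump Z (r n)) = Z := funext fun n => h Z n
  rwa [heq] at this

open Classical in
theorem ttComputable_nonempty : TTComputable (jump Z) fun q => decide (piClass q).Nonempty := by
  have h1 := ttComputable_decide_rePred Z (rePred_of_primrecRel (R := SeenEmpty)
    (primrec_seenEmpty Primrec.fst Primrec.snd))
  have h2 := h1.map (F := fun _ b => !b) (Primrec.not.comp Primrec.snd)
  have heq : (fun q => !decide (∃ s, SeenEmpty q s)) = fun q => decide (piClass q).Nonempty := by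
    funext q
    rw [← piClass_eq_empty_iff, ← decide_not]
    exact decide_eq_decide.2 Set.nonempty_iff_ne_empty.symm
  rwa [heq] at h2

theorem ttComputable_splitPos (m : ℕ) : TTComputable (jump Z) (splitPos m) := by
  classical
  have hb : ∀ b : Bool, TTComputable (jump Z)
      fun x : ℕ × ℕ => decide (piClass (splitIndex x.1 x.2 b)).Nonempty := fun b =>
    (ttComputable_nonempty Z).comp_primrec
      (primrec_splitIndex Primrec.fst Primrec.snd (Primrec.const b))
  have h1 : TTComputable (jump Z) fun x : ℕ × ℕ => decide (SplitsAt x.1 x.2) := by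
    have h := ((hb false).pair (hb true)).map (F := fun _ c => c.1 && c.2)
      (Primrec.and.comp (Primrec.fst.comp Primrec.snd) (Primrec.snd.comp Primrec.snd))
    have heq : (fun x : ℕ × ℕ => (decide (piClass (splitIndex x.1 x.2 false)).Nonempty &&
        decide (piClass (splitIndex x.1 x.2 true)).Nonempty)) =
        fun x => decide (SplitsAt x.1 x.2) := by
      funext x
      rw [Bool.eq_iff_iff, Bool.and_eq_true, decide_eq_true_iff, decide_eq_true_iff,
        decide_eq_true_iff, SplitsAt]
    rwa [heq] at h
  have hn : Primrec fun q => m + q + 1 :=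
    Primrec.succ.comp (Primrec.nat_add.comp (Primrec.const m) Primrec.id)
  have hfind : Primrec fun l : List Bool => l.findIdx id :=
    Primrec.list_findIdx Primrec.id Primrec.snd
  exact (h1.list_map_range hn).map (F := fun (_ : ℕ) (l : List Bool) => l.findIdx id)
    (hfind.comp Primrec.snd)

variable {d : ℕ → Option (ℕ × ℕ)}

theorem ttComputable_finalResets (hd : Primrec d) :
    TTComputable (jump Z) (finalResets d) := by
  classical
  have h1 := ttComputable_decide_rePred Z (rePred_of_primrecRel
    (R := fun (x : ℕ × ℕ) s => x.2 < resets d x.1 s)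
    (Primrec.nat_lt.comp (Primrec.snd.comp Primrec.fst)
      ((primrec_resets hd).comp (Primrec.fst.comp Primrec.fst) Primrec.snd)))
  have hn : Primrec fun k => 2 ^ k + 1 :=
    Primrec.succ.comp (primrec_nat_pow.comp (Primrec.const 2) Primrec.id)
  have hfind : Primrec fun l : List Bool => l.findIdx (! ·) :=
    Primrec.list_findIdx Primrec.id (Primrec.not.comp Primrec.snd)
  exact (h1.list_map_range hn).map (F := fun (_ : ℕ) (l : List Bool) => l.findIdx (! ·))
    (hfind.comp Primrec.snd)

theorem ttComputable_satisfyIndex (hd : Primrec d) :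
    TTComputable (jump Z) fun x : ℕ × ℕ => satisfyIndex hd x.1 x.2 := by
  classical
  have hk : Primrec fun x : ℕ × ℕ => Nat.pair x.1 x.2 := Primrec₂.natPair
  have h1 := (ttComputable_decide_rePred Z (rePred_of_primrecRel
    (primrec_acts hd (primrec_avoidSeenEmpty hd)))).comp_primrec hk
  have h2 := (ttComputable_finalResets Z hd).comp_primrec hk
  have h3 := (h1.pair h2).map (F := fun (x : ℕ × ℕ) c =>
    if c.1 = true then x.2 else avoidIndex hd (Nat.pair x.1 x.2, c.2)) (by
      refine Primrec.ite (Primrec.eq.comp (Primrec.fst.comp Primrec.snd) (Primrec.const true))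
        (Primrec.snd.comp Primrec.fst) ((primrec_avoidIndex hd).comp (Primrec.pair
          (hk.comp Primrec.fst) (Primrec.snd.comp Primrec.snd))))
  have heq : (fun x : ℕ × ℕ => satisfyIndex hd x.1 x.2) = fun x =>
      if decide (∃ s, Acts d (AvoidSeenEmpty hd) (Nat.pair x.1 x.2) s) = true then x.2 else
        avoidIndex hd (Nat.pair x.1 x.2, finalResets d (Nat.pair x.1 x.2)) := by
    funext x
    simp [satisfyIndex]
  rw [heq]
  exact h3

end Jump

/-! ### Coding an arbitrary set -/

/-- The sequence of indices of shrinking `Π⁰₁` classes: the `e`-th step codes `G(e)` into the value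
at the first position where the class splits, and then takes care of `Φ_e`. -/
noncomputable def codingIndex {d : ℕ → Option (ℕ × ℕ)} (hd : Primrec d) (m q₀ : ℕ) (G : ℕ → Bool) :
    ℕ → ℕ
  | 0 => q₀
  | e + 1 => satisfyIndex hd e (splitIndex (codingIndex hd m q₀ G e)
      (splitPos m (codingIndex hd m q₀ G e)) (G e))

/-- Every set `G` is truth-table reducible to the jump of a member of the given class that does not
compute the enumerated set. -/
theorem exists_mem_coding {d : ℕ → Option (ℕ × ℕ)} (hd : Primrec d)
    (hle : ∀ t p, d t = some p → p.1 ≤ t ∧ p.2 ≤ t) (hw : ∑' t, weight (d t) ≤ 1) {m q₀ : ℕ}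
    (hne : (piClass q₀).Nonempty) (hdisj : Disjoint (piClass q₀) (openOf (splitTest m)))
    (G : ℕ → Bool) : ∃ Z ∈ piClass q₀,
      ¬ TReducible (enumSet d (AvoidSeenEmpty hd)) Z ∧ TTReducible G (jump Z) := by
  set Q := codingIndex hd m q₀ G with hQ
  let P : ℕ → ℕ := fun e => splitIndex (Q e) (splitPos m (Q e)) (G e)
  have hstep : ∀ e, Q (e + 1) = satisfyIndex hd e (P e) := fun e => rfl
  have hPQ : ∀ e, piClass (P e) ⊆ piClass (Q e) := fun e Z hZ => (mem_piClass_splitIndex.1 hZ).1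
  have hinv : ∀ e, (piClass (Q e)).Nonempty ∧ piClass (Q e) ⊆ piClass q₀ := by
    intro e
    induction e with
    | zero => exact ⟨hne, subset_rfl⟩
    | succ e ih =>
      have h := satisfyIndex_spec hd hle hw e
        (splitsAt_splitPos ih.1 (hdisj.mono_left ih.2) (G e))
      exact ⟨h.1, h.2.1.trans ((hPQ e).trans ih.2)⟩
  have hspec := fun e => satisfyIndex_spec hd hle hw e
    (splitsAt_splitPos (hinv e).1 (hdisj.mono_left (hinv e).2) (G e))
  obtain ⟨Z, hZ⟩ := IsCompact.nonempty_iInter_of_sequence_nonempty_isCompact_isClosed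
    (fun e => piClass (Q e)) (fun e => (hspec e).2.1.trans (hPQ e)) (fun e => (hinv e).1)
    (isClosed_piClass _).isCompact (fun e => isClosed_piClass _)
  rw [Set.mem_iInter] at hZ
  refine ⟨Z, hZ 0, fun hred => ?_, ?_⟩
  · obtain ⟨c, hc⟩ := (OCode.turingReducible_iff_exists_eval _ _).1 hred
    refine (hspec c.toNat).2.2 Z (hZ (c.toNat + 1)) ?_
    rw [Phi, OCode.ofNat_toNat, hc]
  -- The sequence `Q` depends on `G`, but `G` can be read off from `Z` along the way.
  · have hG : ∀ e, G e = Z (splitPos m (Q e)) := fun e =>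
      (mem_piClass_splitIndex.1 ((hspec e).2.1 (hZ (e + 1)))).2.symm
    have hpos := ttComputable_splitPos Z m
    have hbit : TTComputable (jump Z) fun q => Z (splitPos m q) :=
      ((ttComputable_self Z).comp_primrec (Primrec.snd (α := ℕ))).bind hpos
    have hidx : TTComputable (jump Z) fun q => splitIndex q (splitPos m q) (Z (splitPos m q)) :=
      (hpos.pair hbit).map (F := fun q c => splitIndex q c.1 c.2) (primrec_splitIndex Primrec.fst
        (Primrec.fst.comp Primrec.snd) (Primrec.snd.comp Primrec.snd))
    have hF : TTComputable (jump Z) fun x : ℕ × ℕ =>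
        satisfyIndex hd x.1 (splitIndex x.2 (splitPos m x.2) (Z (splitPos m x.2))) :=
      ((ttComputable_satisfyIndex Z hd).comp_primrec (h := fun y : (ℕ × ℕ) × ℕ => (y.1.1, y.2))
        (Primrec.pair (Primrec.fst.comp Primrec.fst) Primrec.snd)).bind
        (hidx.comp_primrec Primrec.snd)
    have hQtt : TTComputable (jump Z) Q := hF.iterate fun e => by
      rw [← hG, hstep]
    have hGtt : TTComputable (jump Z) fun e => Z (splitPos m (Q e)) :=
      (hbit.comp_primrec (Primrec.snd (α := ℕ))).bind hQtt
    rw [← funext hG] at hGtt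
    exact hGtt.ttReducible

end Cantor

theorem theorem3p5 (S : Set (ℕ → Bool)) (hS : Cantor.IsPi01Class S) (hne : S.Nonempty)
    (hML : ∀ Z ∈ S, Cantor.IsMLRandom Z) :
    ∃ B : ℕ → Bool, Cantor.IsCE B ∧ Cantor.IsKTrivial B ∧
      ∀ G : ℕ → Bool, ∃ Z ∈ S,
        ¬ Cantor.TReducible B Z ∧ Cantor.TTReducible G (Cantor.jump Z) := by
  obtain ⟨U, hU⟩ := Cantor.exists_isOptimalMachine
  obtain ⟨d, hd, hle, hw, hdescr⟩ := Cantor.exists_descriptions hU.1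
  have hT := Cantor.primrec_avoidSeenEmpty hd
  refine ⟨_, Cantor.isCE_enumSet hd hT, Cantor.isKTrivial_enumSet hU hd hle hw hdescr hT,
    fun G => ?_⟩
  obtain ⟨Z₀, hZ₀⟩ := hne
  obtain ⟨m, hm⟩ := hML Z₀ hZ₀ _ Cantor.isMLTest_splitTest
  obtain ⟨q₀, hq₀⟩ := Cantor.exists_piClass_eq
    (hS.diff_openOf (Cantor.rePred_section Cantor.rePred_splitTest m))
  obtain ⟨Z, hZ, h⟩ := Cantor.exists_mem_coding hd hle hw (m := m) (q₀ := q₀)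
    (hq₀ ▸ ⟨Z₀, hZ₀, hm⟩) (hq₀ ▸ Set.disjoint_sdiff_left) G
  exact ⟨Z, (hq₀ ▸ hZ : Z ∈ S \ _).1, h⟩
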